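/- Let $d\ge 1$ and let $p\in\mathbb{C}[z_1,\dots,z_d]$ have polydegree $(n_1,\dots,n_d)$ (i.e. degree $n_j$ in $z_j$), with $n_j\ge 1$ for every $j$. Suppose that $p$ has no zeros in the open polydisk $\mathbb{D}^d$, let $\tilde p(z)=z_1^{n_1}\cdots z_d^{n_d}\,\overline{p(1/\bar z_1,\dots,1/\bar z_d)}$ be its reflection, and suppose that the rational inner function $\phi=\tilde p/p$ has no singularities on $\overline{\mathbb{D}}^d$, i.e. $p$ and $\tilde p$ have no common zero in $\overline{\mathbb{D}}^d$. Let $\alpha\in\mathbb{T}$. Then there is exactly one finite positive Borel measure $\sigma_\alpha$ on $\mathbb{T}^d$ (the Clark measure of $\phi$) with $$\frac{1-|\phi(z)|^2}{|\alpha-\phi(z)|^2}=\int_{\mathbb{T}^d}\prod_{j=1}^d\frac{1-|z_j|^2}{|\zeta_j-z_j|^2}\,d\sigma_\alpha(\zeta)\qquad(z\in\mathbb{D}^d).$$ Let $\mathcal{C}_\alpha(\phi)$ be the closure of $\{\zeta\in\mathbb{T}^d:\lim_{r\to1^-}\phi(r\zeta)=\alpha\}$. For every $\tau\in\mathbb{T}^{d-1}$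 there are functions $g^\alpha_1,\dots,g^\alpha_{n_d}:\mathbb{T}^{d-1}\to\mathbb{T}$, each analytic at every point of $\{\zeta'\in\mathbb{T}^{d-1}:\zeta'_i\ne\tau_i \text{ for all } i\}$ (i.e. near such a point it is the restriction of a holomorphic function of $d-1$ variables), such that $$\mathcal{C}_\alpha(\phi)=\bigcup_{j=1}^{n_d}\{(\zeta',g^\alpha_j(\zeta')):\zeta'\in\mathbb{T}^{d-1}\}.$$ For every $\tau$ and every such family $g^\alpha_1,\dots,g^\alpha_{n_d}$, the derivative $\frac{\partial\phi}{\partial z_d}(\zeta',g^\alpha_j(\zeta'))$ is nonzero for all $j$ and all $\zeta'\in\mathbb{T}^{d-1}$, and for every $f\in C(\mathbb{T}^d)$ the integrands on the right below are integrable and $$\int_{\mathbb{T}^d}f\,d\sigma_\alpha=\sum_{j=1}^{n_d}\int_{\mathbb{T}^{d-1}}f(\zeta',g^\alpha_j(\zeta'))\,\frac{dm(\zeta')}{\left|\frac{\partial\phi}{\partial z_d}(\zeta',g^\alpha_j(\zeta'))\right|},$$ where $m$ is normalized Lebesgue measure on $\mathbb{T}^{d-1}$ (the unit point mass if $d=1$).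 -/

import Mathlib

open MeasureTheory Filter Topology MvPolynomial
open scoped ComplexConjugate

noncomputable section

instance Circle.instMeasurableSpaceBorel : MeasurableSpace Circle := borel Circle

instance Circle.instBorelSpaceBorel : BorelSpace Circle := ⟨rfl⟩

namespace PolydiskClark

/-- Normalized arc length on the unit circle: the image of `dt / (2π)` on `(0, 2π]` under
`t ↦ exp (i t)`. -/
def arcLength : Measure Circle :=
  (ENNReal.ofReal (2 * Real.pi))⁻¹ •
    (volume.restrict (Set.Ioc (0 : ℝ) (2 * Real.pi))).map Circle.exp

instance : IsProbabilityMeasure arcLength := by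
  refine ⟨?_⟩
  have h : ENNReal.ofReal (2 * Real.pi) ≠ 0 := by
    simpa using Real.pi_pos
  rw [arcLength, Measure.smul_apply,
    Measure.map_apply Circle.exp.continuous.measurable MeasurableSet.univ]
  simp only [Set.preimage_univ, Measure.restrict_apply_univ, Real.volume_Ioc, sub_zero,
    smul_eq_mul]
  exact ENNReal.inv_mul_cancel h ENNReal.ofReal_ne_top

/-- Normalized Lebesgue measure `m` on the torus `𝕋ᵈ` (the point mass when `d = 0`). -/
def torusMeasure (d : ℕ) : Measure (Fin d → Circle) :=
  Measure.pi fun _ => arcLength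

/-- The inclusion `𝕋ᵈ ⊆ ℂᵈ`. -/
def toComplex {d : ℕ} (ζ : Fin d → Circle) : Fin d → ℂ := fun j => (ζ j : ℂ)

/-- The open unit polydisk `𝔻ᵈ`. -/
def polydisk (d : ℕ) : Set (Fin d → ℂ) := {z | ∀ j, ‖z j‖ < 1}

/-- The closed unit polydisk. -/
def closedPolydisk (d : ℕ) : Set (Fin d → ℂ) := {z | ∀ j, ‖z j‖ ≤ 1}

/-- `p` has polydegree `n`: it has degree `n j` in the variable `z j`, for every `j`. -/
def HasPolydegree {d : ℕ} (p : MvPolynomial (Fin d) ℂ) (n : Fin d → ℕ) : Prop :=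
  ∀ j, p.degreeOf j = n j

/-- `p` has no zeros in the open polydisk. -/
def IsStable {d : ℕ} (p : MvPolynomial (Fin d) ℂ) : Prop :=
  ∀ z ∈ polydisk d, eval z p ≠ 0

/-- The polydegree of `p` as an exponent vector. -/
def polydegree {d : ℕ} (p : MvPolynomial (Fin d) ℂ) : Fin d →₀ ℕ :=
  Finsupp.equivFunOnFinite.symm fun j => p.degreeOf j

/-- The reflection `p̃` of `p`: for `p = ∑ₘ cₘ zᵐ` of polydegree `n`, this is the polynomial
`∑ₘ conj(cₘ) zⁿ⁻ᵐ`. -/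
def reflection {d : ℕ} (p : MvPolynomial (Fin d) ℂ) : MvPolynomial (Fin d) ℂ :=
  ∑ m ∈ p.support, monomial (polydegree p - m) (conj (coeff m p))

/-- The usual formula `p̃(z) = z₁^{n₁} ⋯ z_d^{n_d} conj(p(1/conj z₁, …, 1/conj z_d))`. -/
theorem eval_reflection {d : ℕ} (p : MvPolynomial (Fin d) ℂ) (z : Fin d → ℂ)
    (hz : ∀ j, z j ≠ 0) :
    eval z (reflection p) =
      (∏ j, z j ^ p.degreeOf j) * conj (eval (fun j => 1 / conj (z j)) p) := by
  rw [reflection, map_sum, eval_eq' _ p, map_sum, Finset.mul_sum]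
  refine Finset.sum_congr rfl fun m hm => ?_
  rw [eval_monomial, Finsupp.prod_fintype _ _ (by simp), map_mul, map_prod, mul_left_comm,
    ← Finset.prod_mul_distrib]
  congr 1
  refine Finset.prod_congr rfl fun j _ => ?_
  have h : m j ≤ p.degreeOf j := monomial_le_degreeOf j hm
  have h' : polydegree p j = p.degreeOf j := rfl
  rw [Finsupp.tsub_apply, h', pow_sub₀ _ (hz j) h]
  simp

/-- The rational function `φ = p̃ / p`. -/
def quotientFun {d : ℕ} (p : MvPolynomial (Fin d) ℂ) (z : Fin d → ℂ) : ℂ :=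
  eval z (reflection p) / eval z p

/-- `τ` is a singularity of `p̃ / p`: a common zero of `p` and `p̃`. -/
def IsSingularity {d : ℕ} (p : MvPolynomial (Fin d) ℂ) (τ : Fin d → ℂ) : Prop :=
  eval τ p = 0 ∧ eval τ (reflection p) = 0

/-- The Poisson kernel `P_z(ζ) = ∏ⱼ (1 - |zⱼ|²) / |ζⱼ - zⱼ|²` of the polydisk. -/
def polyPoisson {d : ℕ} (z : Fin d → ℂ) (ζ : Fin d → Circle) : ℝ :=
  ∏ j, (1 - ‖z j‖ ^ 2) / ‖(ζ j : ℂ) - z j‖ ^ 2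

/-- `σ` is the Aleksandrov–Clark measure of `φ` for the parameter `α`: the positive (finite) Borel
measure on the torus whose Poisson integral is `(1 - |φ|²) / |α - φ|²`. -/
structure IsClarkMeasure {d : ℕ} (φ : (Fin d → ℂ) → ℂ) (α : Circle)
    (σ : Measure (Fin d → Circle)) : Prop where
  finite : IsFiniteMeasure σ
  poisson_integral : ∀ z ∈ polydisk d,
    (1 - ‖φ z‖ ^ 2) / ‖(α : ℂ) - φ z‖ ^ 2 = ∫ ζ, polyPoisson z ζ ∂σ

/-- The unimodular level set `𝒞_α(φ)`: the closure of the set of `ζ ∈ 𝕋ᵈ` at which the radial limit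
of `φ` exists and equals `α`. -/
def levelSet {d : ℕ} (φ : (Fin d → ℂ) → ℂ) (α : Circle) : Set (Fin d → Circle) :=
  closure {ζ | Tendsto (fun r : ℝ => φ fun j => (r : ℂ) * (ζ j : ℂ)) (𝓝[<] 1) (𝓝 (α : ℂ))}

/-- `g : 𝕋ᵈ → 𝕋` is analytic at `ζ`: near `ζ` it is the restriction to the torus of a function
that is holomorphic near `ζ` in `ℂᵈ`. -/
def AnalyticAtTorus {d : ℕ} (g : (Fin d → Circle) → Circle) (ζ : Fin d → Circle) : Prop :=
  ∃ G : (Fin d → ℂ) → ℂ, AnalyticAt ℂ G (toComplex ζ) ∧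
    ∀ᶠ η in 𝓝 ζ, (g η : ℂ) = G (toComplex η)

/-- The point `(ζ', w)` of `𝕋ᵈ × 𝕋 = 𝕋ᵈ⁺¹`. -/
def joinLast {d : ℕ} (ζ' : Fin d → Circle) (w : Circle) : Fin (d + 1) → Circle :=
  Fin.snoc (α := fun _ => Circle) ζ' w

/-- The functions `g₁, …, g_N` parametrize the level set `𝒞_α(φ) ⊆ 𝕋ᵈ⁺¹`: it is the union of
their graphs, and every `gⱼ` is analytic on `𝕋ᵈ` off the cuts `ζᵢ = τᵢ`, where the branches
are allowed to jump (continuation around a circle may permute them). -/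
structure IsParametrization {d N : ℕ} (φ : (Fin (d + 1) → ℂ) → ℂ) (α : Circle)
    (τ : Fin d → Circle) (g : Fin N → (Fin d → Circle) → Circle) : Prop where
  analytic : ∀ j ζ', (∀ i, ζ' i ≠ τ i) → AnalyticAtTorus (g j) ζ'
  levelSet_eq : levelSet φ α = ⋃ j, Set.range fun ζ' => joinLast ζ' (g j ζ')

/-- The complex partial derivative of `φ` in the last variable. -/
def partialLast {d : ℕ} (φ : (Fin (d + 1) → ℂ) → ℂ) (z : Fin (d + 1) → ℂ) : ℂ :=
  deriv (fun w => φ (Function.update z (Fin.last d) w)) (z (Fin.last d))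

end PolydiskClark

end

/-!
Points of `𝕋ᵈ⁺¹` are written `(ζ', w)` with `ζ' ∈ 𝕋ᵈ`, and `N` is the degree of `p` in the last
variable `w`.

Stability propagates to the closed polydisk: a zero of `p` there could be moved, one coordinate at
a time, to a zero on the torus, where it would also be a zero of `p̃`
(`IsStable.eval_ne_zero_of_not_isSingularity`). Hence `φ = p̃ / p` is analytic near the closed
polydisk, `𝒞_α(φ)` is the set of points of the torus with `φ = α`, and for every `ζ'` in the torus
`φ(ζ', ·)` is a finite Blaschke product `b` of degree `N` (`isBlaschkePair_slice`). On the circle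
`w b'(w) / b(w) = N - 2 Re (w q'(w) / q(w)) > 0` with `q = p(ζ', ·)`, so `∂φ/∂w` does not vanish
on the torus.

If `L` is a continuous logarithm of `p`, then `φ = exp (i Ψ)` on the torus with
`Ψ = ∑ nⱼ θⱼ - 2 Im L` in the angles `θ` (`exists_phase`). The phase `Ψ` increases strictly in the
last angle, and by `2π N` per turn, so the equation `φ(ζ', w) = α` has exactly `N` solutions,
which depend continuously on the angles of `ζ'` (`exists_branches`) and, by the implicit function
theorem, analytically on `ζ'` (`analyticAtTorus_of_continuousAt`). Angles that jump only at the cuts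
`ζ'ᵢ = τᵢ` turn these solutions into a parametrization of `𝒞_α(φ)`.

For a finite Blaschke product, the partial fraction decomposition of `(α + b) / (α - b)` shows that
its Clark measure has mass `1 / |b'(w)|` at each solution of `b(w) = α`
(`IsBlaschkePair.clark_formula`). For fixed `w` in the disk, `(1 - |φ|²) / |α - φ|²` is the real
part of a function of `z'` that is holomorphic near the closed polydisk, hence the Poisson integral
of its values on `𝕋ᵈ` (`integral_polyPoisson_mul_clark`). Together these say that the measure on
the branches with density `1 / |∂φ/∂w|` is a Clark measure of `φ`. Poisson integrals determine the
Fourier coefficients of a measure, so it is the only one (`measure_ext_of_integral_polyPoisson`).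
-/

namespace PolydiskClark

/-! ### One-variable slices and zeros on the closed polydisk -/

/-- The one-variable polynomial obtained from `p` by freezing every variable except the `j`-th at
the coordinates of `z`; the coordinate `z j` itself plays no role. -/
noncomputable def slice {d : ℕ} (p : MvPolynomial (Fin d) ℂ) (z : Fin d → ℂ) (j : Fin d) :
    Polynomial ℂ :=
  aeval (Function.update (fun i => Polynomial.C (z i)) j Polynomial.X) p

theorem eval_slice {d : ℕ} (p : MvPolynomial (Fin d) ℂ) (z : Fin d → ℂ) (j : Fin d) (w : ℂ) :
    (slice p z j).eval w = eval (Function.update z j w) p := by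
  have : (Polynomial.evalRingHom w).comp
      ((aeval (Function.update (fun i => Polynomial.C (z i)) j Polynomial.X) :
        MvPolynomial (Fin d) ℂ →ₐ[ℂ] Polynomial ℂ) : MvPolynomial (Fin d) ℂ →+* Polynomial ℂ)
      = eval (Function.update z j w) := by
    apply MvPolynomial.ringHom_ext
    · intro r
      simp
    · intro i
      by_cases h : i = j
      · subst h; simp
      · simp [h]
  exact congrArg (fun f => f p) this

theorem natDegree_slice_le {d : ℕ} (p : MvPolynomial (Fin d) ℂ) (z : Fin d → ℂ) (j : Fin d) :
    (slice p z j).natDegree ≤ p.degreeOf j := by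
  rw [slice, aeval_def, eval₂_eq']
  -- only the factor with index `j` of each monomial contributes to the degree
  refine Polynomial.natDegree_sum_le_of_forall_le _ _ fun m hm => ?_
  refine (Polynomial.natDegree_C_mul_le _ _).trans ?_
  refine (Polynomial.natDegree_prod_le _ _).trans ?_
  rw [Finset.sum_eq_single j]
  · simpa using monomial_le_degreeOf j hm
  · intro i _ hi
    rw [Function.update_of_ne hi, ← Polynomial.C_pow, Polynomial.natDegree_C]
  · simp

theorem degreeOf_reflection_le {d : ℕ} (p : MvPolynomial (Fin d) ℂ) (j : Fin d) :
    (reflection p).degreeOf j ≤ p.degreeOf j := by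
  rw [reflection]
  refine (degreeOf_sum_le _ _ _).trans (Finset.sup_le fun m _ => ?_)
  refine degreeOf_le_iff.mpr fun k hk => ?_
  have := support_monomial_subset hk
  rw [Finset.mem_singleton] at this
  subst this
  exact Nat.sub_le _ _

/-- On the torus, `p̃ = ζⁿ · conj p`. -/
theorem eval_reflection_toComplex {d : ℕ} (p : MvPolynomial (Fin d) ℂ) (ζ : Fin d → Circle) :
    eval (toComplex ζ) (reflection p) =
      (∏ j, (ζ j : ℂ) ^ p.degreeOf j) * conj (eval (toComplex ζ) p) := by
  have h : (fun j => 1 / conj (toComplex ζ j)) = toComplex ζ := by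
    ext j
    simp [toComplex, ← Circle.coe_inv_eq_conj]
  have h' := eval_reflection p (toComplex ζ) fun j => Circle.coe_ne_zero (ζ j)
  rw [h] at h'
  exact h'

/-- A Harnack-type inequality for polynomials without zeros in the unit disk. It survives limits
of polynomials of bounded degree, and so plays the role of Hurwitz's theorem. -/
theorem norm_eval_ge_of_roots_outside (q : Polynomial ℂ) (N : ℕ) (hN : q.natDegree ≤ N)
    (hq : ∀ w : ℂ, ‖w‖ < 1 → q.eval w ≠ 0) (w u : ℂ) (hw : ‖w‖ < 1) (hu : ‖u‖ ≤ 1) :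
    ((1 - ‖w‖) / 3) ^ N * ‖q.eval u‖ ≤ ‖q.eval w‖ := by
  have hsp := IsAlgClosed.splits q
  have hq0 : q ≠ 0 := by
    rintro rfl
    exact hq 0 (by simp) (by simp)
  have hpos : 0 ≤ (1 - ‖w‖) / 3 := by linarith
  have hle1 : (1 - ‖w‖) / 3 ≤ 1 := by linarith [norm_nonneg w]
  have key : ∀ s : Multiset ℂ, (∀ r ∈ s, 1 ≤ ‖r‖) →
      ((1 - ‖w‖) / 3) ^ s.card * ‖(s.map fun a => u - a).prod‖ ≤ ‖(s.map fun a => w - a).prod‖ := by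
    intro s
    induction s using Multiset.induction_on with
    | empty => simp
    | cons r s ih =>
      intro h
      have h1 := ih fun a ha => h a (Multiset.mem_cons_of_mem ha)
      have hr := h r (Multiset.mem_cons_self r s)
      have h2 : (1 - ‖w‖) / 3 * ‖u - r‖ ≤ ‖w - r‖ := by
        have a1 : ‖u - r‖ ≤ 2 + ‖w - r‖ := by
          have : u - r = u - w + (w - r) := by ring
          rw [this]
          linarith [norm_add_le (u - w) (w - r), norm_sub_le u w]
        have a2 : 1 - ‖w‖ ≤ ‖w - r‖ := by
          have := norm_sub_norm_le r w
          rw [norm_sub_rev] at this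
          linarith
        have : (1 - ‖w‖) * ‖w - r‖ ≤ 1 * ‖w - r‖ := by
          gcongr
          linarith [norm_nonneg w]
        have : (1 - ‖w‖) * ‖u - r‖ ≤ (1 - ‖w‖) * (2 + ‖w - r‖) := by
          gcongr
        linarith
      simp only [Multiset.card_cons, Multiset.map_cons, Multiset.prod_cons, norm_mul, pow_succ]
      calc _ = ((1 - ‖w‖) / 3 * ‖u - r‖) *
            (((1 - ‖w‖) / 3) ^ s.card * ‖(s.map fun a => u - a).prod‖) := by ring
        _ ≤ _ := by gcongr
  have hroots : ∀ r ∈ q.roots, 1 ≤ ‖r‖ := by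
    intro r hr
    by_contra! h
    exact hq r h (Polynomial.isRoot_of_mem_roots hr)
  have hk := key q.roots hroots
  rw [hsp.eval_eq_prod_roots u, hsp.eval_eq_prod_roots w, norm_mul, norm_mul]
  have hc : q.roots.card ≤ N := (Polynomial.card_roots' q).trans hN
  have hpow : ((1 - ‖w‖) / 3) ^ N ≤ ((1 - ‖w‖) / 3) ^ q.roots.card :=
    pow_le_pow_of_le_one hpos hle1 hc
  calc _ = ‖q.leadingCoeff‖ *
        (((1 - ‖w‖) / 3) ^ N * ‖(q.roots.map fun a => u - a).prod‖) := by ring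
    _ ≤ ‖q.leadingCoeff‖ *
        (((1 - ‖w‖) / 3) ^ q.roots.card * ‖(q.roots.map fun a => u - a).prod‖) := by gcongr
    _ ≤ _ := by gcongr

/-- A stable polynomial that vanishes at a point of the closed polydisk whose `j`-th coordinate is
in the open disk vanishes on the whole slice through that point. -/
theorem IsStable.eval_update_eq_zero {d : ℕ} {p : MvPolynomial (Fin d) ℂ} (hp : IsStable p)
    {z : Fin d → ℂ} (hz : z ∈ closedPolydisk d) (h0 : eval z p = 0) (j : Fin d)
    (hj : ‖z j‖ < 1) {u : ℂ} (hu : ‖u‖ ≤ 1) : eval (Function.update z j u) p = 0 := by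
  have hr : ∀ r : ℝ, r ∈ Set.Ioo (0 : ℝ) 1 →
      ((1 - ‖z j‖) / 3) ^ p.degreeOf j * ‖eval (Function.update (fun i => (r : ℂ) * z i) j u) p‖
        ≤ ‖eval (Function.update (fun i => (r : ℂ) * z i) j (z j)) p‖ := by
    intro r hr
    rw [← eval_slice, ← eval_slice]
    refine norm_eval_ge_of_roots_outside _ _ (natDegree_slice_le _ _ _) (fun w hw => ?_) _ _ hj hu
    rw [eval_slice]
    apply hp
    intro i
    by_cases h : i = j
    · subst h; simpa using hw
    · rw [Function.update_of_ne h, norm_mul, Complex.norm_real, Real.norm_of_nonneg hr.1.le]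
      calc r * ‖z i‖ ≤ r * 1 := by gcongr; exacts [hr.1.le, hz i]
        _ < 1 := by linarith [hr.2]
  have hcont : ∀ v : ℂ, Continuous fun r : ℝ =>
      ‖eval (Function.update (fun i => (r : ℂ) * z i) j v) p‖ := by
    intro v
    have h1 : Continuous fun r : ℝ => Function.update (fun i => (r : ℂ) * z i) j v := by
      fun_prop
    exact ((MvPolynomial.continuous_eval p).comp h1).norm
  have hlim : ((1 - ‖z j‖) / 3) ^ p.degreeOf j *
      ‖eval (Function.update (fun i => ((1 : ℝ) : ℂ) * z i) j u) p‖
        ≤ ‖eval (Function.update (fun i => ((1 : ℝ) : ℂ) * z i) j (z j)) p‖ := by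
    refine le_of_tendsto_of_tendsto (b := 𝓝[<] (1 : ℝ))
      (((hcont u).const_mul _).continuousWithinAt) ((hcont (z j)).continuousWithinAt) ?_
    filter_upwards [Ioo_mem_nhdsLT (show (0 : ℝ) < 1 by norm_num)] with r h using hr r h
  simp only [Complex.ofReal_one, one_mul, Function.update_eq_self, h0, norm_zero] at hlim
  have hpos : 0 < ((1 - ‖z j‖) / 3) ^ p.degreeOf j := by
    have : 0 < 1 - ‖z j‖ := by linarith
    positivity
  have : ‖eval (Function.update z j u) p‖ ≤ 0 := by
    by_contra! h
    linarith [mul_pos hpos h]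
  simpa using this

/-- A stable polynomial without singularities has no zeros in the closed polydisk: a zero could be
moved, one coordinate at a time, to a zero on the torus, where `p̃` vanishes as well. -/
theorem IsStable.eval_ne_zero_of_not_isSingularity {d : ℕ} {p : MvPolynomial (Fin d) ℂ}
    (hp : IsStable p) (hsing : ∀ z ∈ closedPolydisk d, ¬ IsSingularity p z) :
    ∀ z ∈ closedPolydisk d, eval z p ≠ 0 := by
  have key : ∀ s : Finset (Fin d), ∀ z ∈ closedPolydisk d, (∀ j ∉ s, ‖z j‖ = 1) →
      eval z p ≠ 0 := by
    intro s
    induction s using Finset.induction_on with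
    | empty =>
      intro z hz h1 h0
      obtain ⟨ζ, rfl⟩ : ∃ ζ : Fin d → Circle, z = toComplex ζ :=
        ⟨fun j => ⟨z j, mem_sphere_zero_iff_norm.2 (h1 j (by simp))⟩, rfl⟩
      refine hsing _ hz ⟨h0, ?_⟩
      rw [eval_reflection_toComplex, h0]
      simp
    | insert j s _ ih =>
      intro z hz h1 h0
      rcases (hz j).lt_or_eq with hj | hj
      · refine ih (Function.update z j 1) (fun i => ?_) (fun i hi => ?_)
          (hp.eval_update_eq_zero hz h0 j hj (by simp))
        · by_cases h : i = j
          · subst h; simp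
          · simpa [h] using hz i
        · by_cases h : i = j
          · subst h; simp
          · rw [Function.update_of_ne h]
            exact h1 i (by simp [h, hi])
      · refine ih z hz (fun i hi => ?_) h0
        by_cases h : i = j
        · subst h; exact hj
        · exact h1 i (by simp [h, hi])
  intro z hz
  exact key Finset.univ z hz (by simp)

/-! ### Finite Blaschke products and their Clark measures -/

/-- The data of a finite Blaschke product `q̃ / q` of degree `n ≥ 1`: a polynomial `q` of degree at
most `n` without zeros in the closed unit disk, and a polynomial `q̃` of degree at most `n` that
agrees on the unit circle with `κ wⁿ conj q(w)`, where `κ` is a unimodular constant. -/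
structure IsBlaschkePair (n : ℕ) (κ : ℂ) (q q' : Polynomial ℂ) : Prop where
  pos : 0 < n
  natDegree_le : q.natDegree ≤ n
  natDegree_le' : q'.natDegree ≤ n
  norm_eq_one : ‖κ‖ = 1
  eval_ne_zero : ∀ w : ℂ, ‖w‖ ≤ 1 → q.eval w ≠ 0
  eval_eq : ∀ w : ℂ, ‖w‖ = 1 → q'.eval w = κ * w ^ n * conj (q.eval w)

theorem re_add_div_sub (a b : ℂ) :
    ((a + b) / (a - b)).re = (‖a‖ ^ 2 - ‖b‖ ^ 2) / ‖a - b‖ ^ 2 := by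
  have h := congrFun (poissonKernel_eq_re_herglotzRieszKernel (c := 0) (w := b)) a
  simpa [poissonKernel_def, herglotzRieszKernel_def] using h.symm

theorem re_div_sub_lt_half {w r : ℂ} (hw : ‖w‖ = 1) (hr : 1 < ‖r‖) : (w / (w - r)).re < 1 / 2 := by
  have hne : w - r ≠ 0 := by
    intro h
    rw [sub_eq_zero.1 h] at hw
    linarith
  have h1 : w / (w - r) = (1 + (w + r) / (w - r)) / 2 := by
    field_simp
    ring
  rw [h1, Complex.div_ofNat_re, Complex.add_re, re_add_div_sub, hw]
  have : (1 ^ 2 - ‖r‖ ^ 2) / ‖w - r‖ ^ 2 < 0 := by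
    apply div_neg_of_neg_of_pos
    · nlinarith
    · have := norm_pos_iff.2 hne
      positivity
  simp only [Complex.one_re]
  linarith

/-- For a polynomial of degree at most `n` with all zeros outside the closed disk,
`Re (w q'(w) / q(w)) < n / 2` on the unit circle. -/
theorem two_mul_re_logDeriv_lt {n : ℕ} (hn : 0 < n) {q : Polynomial ℂ} (hdeg : q.natDegree ≤ n)
    (hq : ∀ w : ℂ, ‖w‖ ≤ 1 → q.eval w ≠ 0) {w : ℂ} (hw : ‖w‖ = 1) :
    2 * (w * (q.derivative.eval w / q.eval w)).re < n := by
  rw [(IsAlgClosed.splits q).eval_derivative_div_eval_of_ne_zero (hq w hw.le),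
    ← Multiset.sum_map_mul_left]
  have key : ∀ s : Multiset ℂ, (∀ r ∈ s, 1 < ‖r‖) →
      2 * ((s.map fun r => w * (1 / (w - r))).sum).re ≤ s.card ∧
      (0 < s.card → 2 * ((s.map fun r => w * (1 / (w - r))).sum).re < s.card) := by
    intro s
    induction s using Multiset.induction_on with
    | empty => simp
    | cons r s ih =>
      intro h
      have h1 := (ih fun a ha => h a (Multiset.mem_cons_of_mem ha)).1
      have h2 := re_div_sub_lt_half hw (h r (Multiset.mem_cons_self r s))
      have h3 : 2 * (((r ::ₘ s).map fun r => w * (1 / (w - r))).sum).re < (r ::ₘ s).card := by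
        rw [Multiset.map_cons, Multiset.sum_cons, Complex.add_re, Multiset.card_cons,
          mul_one_div]
        push_cast
        linarith
      exact ⟨h3.le, fun _ => h3⟩
  have hroots : ∀ r ∈ q.roots, 1 < ‖r‖ := by
    intro r hr
    by_contra! h
    exact hq r h (Polynomial.isRoot_of_mem_roots hr)
  have hk := key _ hroots
  have hc : q.roots.card ≤ n := (Polynomial.card_roots' q).trans hdeg
  rcases Nat.eq_zero_or_pos q.roots.card with h0 | h0
  · have h1 := hk.1
    rw [h0] at h1
    have : (0 : ℝ) < n := by exact_mod_cast hn
    push_cast at h1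
    linarith
  · have : (q.roots.card : ℝ) ≤ n := by exact_mod_cast hc
    linarith [hk.2 h0]

theorem hasDerivAt_exp_mul_I (t : ℝ) : HasDerivAt (fun s : ℝ => Complex.exp (s * Complex.I))
    (Complex.exp (t * Complex.I) * Complex.I) t := by
  have := ((hasDerivAt_id (t : ℂ)).mul_const Complex.I).cexp.comp_ofReal
  simpa using this

namespace IsBlaschkePair

variable {n : ℕ} {κ : ℂ} {q q' : Polynomial ℂ}

theorem norm_eval_eq (h : IsBlaschkePair n κ q q') {w : ℂ} (hw : ‖w‖ = 1) :
    ‖q'.eval w‖ = ‖q.eval w‖ := by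
  rw [h.eval_eq w hw]
  simp [hw, h.norm_eq_one]

theorem norm_div_eq_one (h : IsBlaschkePair n κ q q') {w : ℂ} (hw : ‖w‖ = 1) :
    ‖q'.eval w / q.eval w‖ = 1 := by
  rw [norm_div, h.norm_eval_eq hw, div_self]
  exact norm_ne_zero_iff.2 (h.eval_ne_zero w hw.le)

theorem hasDerivAt (h : IsBlaschkePair n κ q q') {w : ℂ} (hw : ‖w‖ ≤ 1) :
    HasDerivAt (fun v => q'.eval v / q.eval v)
      ((q'.derivative.eval w * q.eval w - q'.eval w * q.derivative.eval w) / q.eval w ^ 2) w :=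
  (q'.hasDerivAt w).div (q.hasDerivAt w) (h.eval_ne_zero w hw)

/-- Differentiating `q̃ = κ wⁿ conj q` along the circle. -/
theorem mul_derivative_eq (h : IsBlaschkePair n κ q q') {w : ℂ} (hw : ‖w‖ = 1) :
    w * q'.derivative.eval w =
      n * q'.eval w - κ * w ^ n * conj (w * q.derivative.eval w) := by
  obtain ⟨t, rfl⟩ : ∃ t : ℝ, Complex.exp (t * Complex.I) = w := by
    exact Complex.norm_eq_one_iff w |>.1 hw
  have hexp := hasDerivAt_exp_mul_I t
  have hn1 : ∀ s : ℝ, ‖Complex.exp (s * Complex.I)‖ = 1 := Complex.norm_exp_ofReal_mul_I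
  have hL : HasDerivAt (fun s : ℝ => q'.eval (Complex.exp (s * Complex.I)))
      (q'.derivative.eval (Complex.exp (t * Complex.I)) *
        (Complex.exp (t * Complex.I) * Complex.I)) t :=
    (q'.hasDerivAt _).comp t hexp
  have hQ : HasDerivAt (fun s : ℝ => q.eval (Complex.exp (s * Complex.I)))
      (q.derivative.eval (Complex.exp (t * Complex.I)) *
        (Complex.exp (t * Complex.I) * Complex.I)) t :=
    (q.hasDerivAt _).comp t hexp
  have hR := ((hexp.pow n).const_mul κ).mul hQ.star
  have heq : (fun s : ℝ => q'.eval (Complex.exp (s * Complex.I))) =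
      ((fun s : ℝ => κ * (fun s : ℝ => Complex.exp (s * Complex.I)) s ^ n) *
        fun s : ℝ => star (q.eval (Complex.exp (s * Complex.I)))) := by
    ext s
    exact h.eval_eq _ (hn1 s)
  rw [heq] at hL
  have := hL.unique hR
  rw [h.eval_eq _ hw]
  obtain ⟨m, rfl⟩ : ∃ m, n = m + 1 := ⟨n - 1, by have := h.pos; omega⟩
  simp only [Nat.add_sub_cancel, star_mul', RCLike.star_def, Complex.conj_I, map_mul,
    Pi.pow_apply] at this ⊢
  have hI : Complex.I ≠ 0 := Complex.I_ne_zero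
  apply mul_right_cancel₀ hI
  push_cast at this ⊢
  linear_combination this

/-- The angular derivative `|b'| = w b' / b` of the Blaschke product `b = q̃ / q` at a point of the
unit circle is `n - 2 Re (w q' / q)`. -/
theorem mul_deriv_eq (h : IsBlaschkePair n κ q q') {w : ℂ} (hw : ‖w‖ = 1) :
    w * deriv (fun v => q'.eval v / q.eval v) w =
      ((n - 2 * (w * (q.derivative.eval w / q.eval w)).re : ℝ) : ℂ) *
        (q'.eval w / q.eval w) := by
  have hq := h.eval_ne_zero w hw.le
  have hq' : conj (q.eval w) ≠ 0 := (map_ne_zero _).2 hq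
  rw [(h.hasDerivAt hw.le).deriv]
  have h2 : ((2 * (w * (q.derivative.eval w / q.eval w)).re : ℝ) : ℂ) =
      w * (q.derivative.eval w / q.eval w) + conj (w * (q.derivative.eval w / q.eval w)) := by
    rw [Complex.add_conj]
  rw [Complex.ofReal_sub, h2]
  have h3 := h.mul_derivative_eq hw
  have h4 := h.eval_eq w hw
  have h5 : conj (w * (q.derivative.eval w / q.eval w)) * q'.eval w =
      κ * w ^ n * conj (w * q.derivative.eval w) := by
    rw [h4]
    simp only [map_mul, map_div₀]
    field_simp
  have h6 : w * ((q'.derivative.eval w * q.eval w - q'.eval w * q.derivative.eval w) /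
      q.eval w ^ 2) = (w * q'.derivative.eval w - w * (q.derivative.eval w / q.eval w) *
        q'.eval w) / q.eval w := by
    field_simp
  rw [h6, h3, ← h5]
  push_cast
  field_simp
  ring

theorem angular_pos (h : IsBlaschkePair n κ q q') {w : ℂ} (hw : ‖w‖ = 1) :
    0 < n - 2 * (w * (q.derivative.eval w / q.eval w)).re := by
  linarith [two_mul_re_logDeriv_lt h.pos h.natDegree_le h.eval_ne_zero hw]

theorem norm_deriv_eq (h : IsBlaschkePair n κ q q') {w : ℂ} (hw : ‖w‖ = 1) :
    ‖deriv (fun v => q'.eval v / q.eval v) w‖ =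
      n - 2 * (w * (q.derivative.eval w / q.eval w)).re := by
  have := congrArg norm (h.mul_deriv_eq hw)
  rw [norm_mul, norm_mul, h.norm_div_eq_one hw, hw, Complex.norm_real,
    Real.norm_of_nonneg (h.angular_pos hw).le] at this
  simpa using this

theorem deriv_ne_zero (h : IsBlaschkePair n κ q q') {w : ℂ} (hw : ‖w‖ = 1) :
    deriv (fun v => q'.eval v / q.eval v) w ≠ 0 := by
  rw [← norm_pos_iff, h.norm_deriv_eq hw]
  exact h.angular_pos hw

theorem norm_div_lt_one (h : IsBlaschkePair n κ q q') {w : ℂ} (hw : ‖w‖ < 1) :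
    ‖q'.eval w / q.eval w‖ < 1 := by
  set b : ℂ → ℂ := fun v => q'.eval v / q.eval v with hb
  have hd : DiffContOnCl ℂ b (Metric.ball 0 1) := by
    apply DifferentiableOn.diffContOnCl
    intro v hv
    rw [closure_ball _ one_ne_zero, mem_closedBall_zero_iff] at hv
    exact (h.hasDerivAt hv).differentiableAt.differentiableWithinAt
  have hle : ∀ v : ℂ, ‖v‖ ≤ 1 → ‖b v‖ ≤ 1 := by
    intro v hv
    refine Complex.norm_le_of_forall_mem_frontier_norm_le Metric.isBounded_ball hd
      (fun z hz => ?_) (by rwa [closure_ball _ one_ne_zero, mem_closedBall_zero_iff])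
    rw [frontier_ball _ one_ne_zero, mem_sphere_zero_iff_norm] at hz
    exact (h.norm_div_eq_one hz).le
  refine (hle w hw.le).lt_of_ne fun h1 => ?_
  -- equality at an interior point makes `b` constant, so that `b' = 0` on the circle
  have hconst : Set.EqOn b (Function.const ℂ (b w)) (Metric.ball 0 1) := by
    refine Complex.eqOn_of_isPreconnected_of_isMaxOn_norm (convex_ball _ _).isPreconnected
      Metric.isOpen_ball hd.differentiableOn (mem_ball_zero_iff.2 hw) fun v hv => ?_
    simp only [Set.mem_ofPred_eq, Function.comp_apply]
    rw [show ‖b w‖ = 1 from h1]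
    exact hle v (mem_ball_zero_iff.1 hv).le
  have hpoly : q' = Polynomial.C (b w) * q := by
    refine Polynomial.eq_of_infinite_eval_eq _ _ (Set.Infinite.mono (s := Metric.ball 0 1) ?_ ?_)
    · intro v hv
      have := hconst hv
      simp only [hb, Function.const_apply] at this
      rw [div_eq_iff (h.eval_ne_zero v (mem_ball_zero_iff.1 hv).le)] at this
      simpa [hb] using this
    · exact infinite_of_mem_nhds (0 : ℂ) (Metric.ball_mem_nhds 0 one_pos)
  apply h.deriv_ne_zero (w := 1) (by simp)
  rw [(h.hasDerivAt (by simp)).deriv, hpoly]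
  simp
  left
  ring

/-- The Clark measure of a finite Blaschke product `b` of degree `n`: it has mass `1 / |b'|` at
each of the `n` solutions of `b = α`. The proof decomposes `(α + b) / (α - b)` into partial
fractions. -/
theorem clark_formula (h : IsBlaschkePair n κ q q') {α : ℂ} (hα : ‖α‖ = 1) (v : Fin n → ℂ)
    (hv : Function.Injective v) (hv1 : ∀ j, ‖v j‖ = 1)
    (hvα : ∀ j, q'.eval (v j) / q.eval (v j) = α) {z : ℂ} (hz : ‖z‖ < 1) :
    (1 - ‖q'.eval z / q.eval z‖ ^ 2) / ‖α - q'.eval z / q.eval z‖ ^ 2 =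
      ∑ j, (1 - ‖z‖ ^ 2) / ‖v j - z‖ ^ 2 /
        ‖deriv (fun w => q'.eval w / q.eval w) (v j)‖ := by
  classical
  set b : ℂ → ℂ := fun v => q'.eval v / q.eval v with hb
  set R : Polynomial ℂ := Polynomial.C α * q - q' with hR
  set N : Polynomial ℂ := Polynomial.C α * q + q' with hN
  have hRe : ∀ w, ‖w‖ ≤ 1 → R.eval w = (α - b w) * q.eval w := by
    intro w hw
    have := h.eval_ne_zero w hw
    simp only [hR, hb, Polynomial.eval_sub, Polynomial.eval_mul, Polynomial.eval_C]
    field_simp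
  have hNe : ∀ w, ‖w‖ ≤ 1 → N.eval w = (α + b w) * q.eval w := by
    intro w hw
    have := h.eval_ne_zero w hw
    simp only [hN, hb, Polynomial.eval_add, Polynomial.eval_mul, Polynomial.eval_C]
    field_simp
  have hdC : (Polynomial.C α * q).natDegree ≤ n :=
    (Polynomial.natDegree_C_mul_le _ _).trans h.natDegree_le
  have hRdeg : R.natDegree ≤ n := by
    simpa using Polynomial.natDegree_sub_le_of_le hdC h.natDegree_le'
  have hNdeg : N.natDegree ≤ n := Polynomial.natDegree_add_le_of_degree_le hdC h.natDegree_le'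
  have hinj : Set.InjOn v (Finset.univ : Finset (Fin n)) := hv.injOn
  -- removing the top coefficient by a multiple of the nodal polynomial lowers the degree
  have hlow : ∀ P : Polynomial ℂ, P.natDegree ≤ n →
      (P - Polynomial.C (P.coeff n) * Lagrange.nodal Finset.univ v).degree <
        (Finset.univ : Finset (Fin n)).card := by
    intro P hP
    rw [Finset.card_univ, Fintype.card_fin, Polynomial.degree_lt_iff_coeff_zero]
    intro m hm
    rw [Polynomial.coeff_sub, Polynomial.coeff_C_mul]
    have hnod : (Lagrange.nodal Finset.univ v : Polynomial ℂ).natDegree = n := by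
      simp [Lagrange.natDegree_nodal]
    rcases hm.lt_or_eq with hm | rfl
    · rw [Polynomial.coeff_eq_zero_of_natDegree_lt (p := P) (n := m) (by omega),
        Polynomial.coeff_eq_zero_of_natDegree_lt (p := Lagrange.nodal Finset.univ v) (by omega)]
      simp
    · have := (Lagrange.nodal_monic (R := ℂ) (s := Finset.univ) (v := v)).coeff_natDegree
      rw [hnod] at this
      rw [this]
      ring
  have hRv : ∀ j, R.eval (v j) = 0 := by
    intro j
    rw [hRe _ (hv1 j).le]
    simp [hb, hvα j]
  have hRnod : R = Polynomial.C (R.coeff n) * Lagrange.nodal Finset.univ v := by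
    rw [← sub_eq_zero]
    refine Polynomial.eq_zero_of_degree_lt_of_eval_index_eq_zero _ hinj (hlow R hRdeg)
      fun j hj => ?_
    simp [hRv j, Lagrange.eval_nodal_at_node hj]
  set c := R.coeff n with hc
  set e := N.coeff n with he
  have hc0 : c ≠ 0 := by
    intro h0
    have h1 := hRe 0 (by simp)
    rw [hRnod, h0] at h1
    simp only [map_zero, zero_mul, Polynomial.eval_zero] at h1
    rcases mul_eq_zero.1 h1.symm with h2 | h2
    · have := h.norm_div_lt_one (w := 0) (by simp)
      rw [sub_eq_zero] at h2
      rw [show q'.eval 0 / q.eval 0 = α from h2.symm, hα] at this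
      exact lt_irrefl _ this
    · exact h.eval_ne_zero 0 (by simp) h2
  have hNint := Lagrange.eq_interpolate hinj (hlow N hNdeg)
  set ρ : Fin n → ℝ := fun j => ‖deriv b (v j)‖ with hρ
  have hρ0 : ∀ j, ρ j ≠ 0 := fun j => norm_ne_zero_iff.2 (h.deriv_ne_zero (hv1 j))
  have hderiv : ∀ j, v j * deriv b (v j) = ρ j * α := by
    intro j
    rw [hb, h.mul_deriv_eq (hv1 j), hvα j, hρ, ← h.norm_deriv_eq (hv1 j)]
  have hv0 : ∀ j, v j ≠ 0 := fun j => by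
    rw [← norm_ne_zero_iff, hv1 j]
    exact one_ne_zero
  have hα0 : α ≠ 0 := by
    rw [← norm_ne_zero_iff, hα]
    exact one_ne_zero
  -- with `w b'(w) = |b'(w)| α` at the nodes, the residues come out as `-2 w / |b'(w)|`
  have hRd : ∀ j, R.derivative.eval (v j) = - (deriv b (v j) * q.eval (v j)) := by
    intro j
    have hq := h.eval_ne_zero (v j) (hv1 j).le
    have h1 := hvα j
    rw [div_eq_iff hq] at h1
    rw [hb, (h.hasDerivAt (hv1 j).le).deriv, h1]
    simp only [hR, Polynomial.derivative_sub, Polynomial.derivative_C_mul, Polynomial.eval_sub,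
      Polynomial.eval_mul, Polynomial.eval_C]
    field_simp
    ring
  have hcoef : ∀ j, c⁻¹ * (Lagrange.nodalWeight Finset.univ v j * N.eval (v j)) =
      - (2 * v j / ρ j) := by
    intro j
    have hq := h.eval_ne_zero (v j) (hv1 j).le
    have h1 : R.derivative.eval (v j) =
        c * (Lagrange.nodal Finset.univ v).derivative.eval (v j) := by
      conv_lhs => rw [hRnod]
      simp
    rw [Lagrange.nodalWeight_eq_eval_derivative_nodal (Finset.mem_univ j), ← mul_assoc,
      ← mul_inv, ← h1, hRd, hNe _ (hv1 j).le]
    simp only [hb, hvα j]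
    have h2 : deriv b (v j) = ρ j * α / v j := by
      rw [← hderiv j]
      field_simp [hv0 j]
    rw [show deriv (fun v => q'.eval v / q.eval v) (v j) = ρ j * α / v j from h2]
    have h3 : (ρ j : ℂ) ≠ 0 := by exact_mod_cast hρ0 j
    have h4 := hv0 j
    field_simp
    ring
  -- the partial fraction decomposition
  have hpf : ∀ w : ℂ, ‖w‖ ≤ 1 → (∀ j, w ≠ v j) →
      (α + b w) / (α - b w) = e / c + ∑ j, (1 / (ρ j : ℂ)) * (1 + (v j + w) / (v j - w)) := by
    intro w hw hne
    have hq := h.eval_ne_zero w hw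
    have h1 : (α + b w) / (α - b w) = N.eval w / R.eval w := by
      rw [hNe w hw, hRe w hw, mul_div_mul_right _ _ hq]
    have hnod : (Lagrange.nodal Finset.univ v).eval w ≠ 0 :=
      Lagrange.eval_nodal_not_at_node fun j _ => hne j
    have h2 : N.eval w = e * (Lagrange.nodal Finset.univ v).eval w +
        (Lagrange.nodal Finset.univ v).eval w * ∑ j,
          Lagrange.nodalWeight Finset.univ v j * (w - v j)⁻¹ * N.eval (v j) := by
      have h3 := congrArg (Polynomial.eval w) hNint
      rw [Lagrange.eval_interpolate_not_at_node _ fun j _ => hne j] at h3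
      simp only [Polynomial.eval_sub, Polynomial.eval_mul, Polynomial.eval_C,
        Lagrange.eval_nodal_at_node (Finset.mem_univ _), mul_zero, sub_zero] at h3
      rw [← h3]
      ring
    rw [h1, h2, hRnod, Polynomial.eval_mul, Polynomial.eval_C]
    rw [← mul_comm ((Lagrange.nodal Finset.univ v).eval w) e, ← mul_add,
      mul_comm c, mul_div_mul_left _ _ hnod, add_div]
    congr 1
    rw [Finset.sum_div]
    refine Finset.sum_congr rfl fun j _ => ?_
    have h4 : w - v j ≠ 0 := sub_ne_zero.2 (hne j)
    have h5 : v j - w ≠ 0 := sub_ne_zero.2 (hne j).symm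
    have h6 : (ρ j : ℂ) ≠ 0 := by exact_mod_cast hρ0 j
    have h7 : Lagrange.nodalWeight Finset.univ v j * (w - v j)⁻¹ * N.eval (v j) / c =
        (w - v j)⁻¹ * (c⁻¹ * (Lagrange.nodalWeight Finset.univ v j * N.eval (v j))) := by
      ring
    rw [h7, hcoef]
    rw [show w - v j = -(v j - w) by ring]
    field_simp
    ring
  have hre : ∀ w : ℂ, ‖w‖ ≤ 1 → (∀ j, w ≠ v j) →
      (1 - ‖b w‖ ^ 2) / ‖α - b w‖ ^ 2 =
        ((e / c).re + ∑ j, 1 / ρ j) + ∑ j, (1 - ‖w‖ ^ 2) / ‖v j - w‖ ^ 2 / ρ j := by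
    intro w hw hne
    have h1 := congrArg Complex.re (hpf w hw hne)
    rw [re_add_div_sub, hα, Complex.add_re, Complex.re_sum, one_pow] at h1
    rw [h1, add_assoc, ← Finset.sum_add_distrib]
    congr 1
    refine Finset.sum_congr rfl fun j _ => ?_
    have h2 : (1 / (ρ j : ℂ)) = ((1 / ρ j : ℝ) : ℂ) := by push_cast; rfl
    rw [h2, Complex.re_ofReal_mul, Complex.add_re, re_add_div_sub, hv1 j, Complex.one_re]
    ring
  -- both sides vanish at a point of the circle off the nodes, which gives the constant
  obtain ⟨w₀, hw₀, hw₀v⟩ : ∃ w : ℂ, ‖w‖ = 1 ∧ ∀ j, w ≠ v j := by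
    have hinf : (Metric.sphere (0 : ℂ) 1).Infinite := by
      have h1 : (Circle.exp '' Set.Ioc 0 (2 * Real.pi)).Infinite :=
        (Set.Ioc_infinite Real.two_pi_pos).image (Circle.exp_injOn_Ioc (by simp))
      refine (h1.image Subtype.coe_injective.injOn).mono ?_
      rintro _ ⟨x, -, rfl⟩
      exact mem_sphere_zero_iff_norm.2 (Circle.norm_coe x)
    obtain ⟨w, hw, hw'⟩ := hinf.exists_notMem_finset (Finset.univ.image v)
    refine ⟨w, by simpa using hw, fun j hj => hw' ?_⟩
    simp [hj]
  have hK := hre w₀ hw₀.le hw₀v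
  have hb1 : ‖b w₀‖ = 1 := h.norm_div_eq_one hw₀
  simp only [hb1, hw₀, one_pow, sub_self, zero_div, Finset.sum_const_zero, add_zero] at hK
  have := hre z hz.le fun j hj => by
    rw [hj, hv1 j] at hz
    exact lt_irrefl _ hz
  rw [← hK, zero_add] at this
  exact this

end IsBlaschkePair

/-! ### The quotient `p̃ / p` on the closed polydisk -/

/-- The point `(z, w)` of `ℂᵈ × ℂ = ℂᵈ⁺¹`. -/
def joinLastC {d : ℕ} (z : Fin d → ℂ) (w : ℂ) : Fin (d + 1) → ℂ :=
  Fin.snoc (α := fun _ => ℂ) z w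

section joinLast

variable {d : ℕ}

@[simp] theorem joinLastC_castSucc (z : Fin d → ℂ) (w : ℂ) (i : Fin d) :
    joinLastC z w i.castSucc = z i := by
  simp [joinLastC]

@[simp] theorem joinLastC_last (z : Fin d → ℂ) (w : ℂ) : joinLastC z w (Fin.last d) = w := by
  simp [joinLastC]

@[simp] theorem joinLast_castSucc (ζ : Fin d → Circle) (w : Circle) (i : Fin d) :
    joinLast ζ w i.castSucc = ζ i := by
  simp [joinLast]

@[simp] theorem joinLast_last (ζ : Fin d → Circle) (w : Circle) :
    joinLast ζ w (Fin.last d) = w := by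
  simp [joinLast]

theorem joinLast_init_last (ζ : Fin (d + 1) → Circle) :
    joinLast (fun i => ζ i.castSucc) (ζ (Fin.last d)) = ζ := by
  ext i
  refine Fin.lastCases ?_ (fun i => ?_) i <;> simp

theorem toComplex_joinLast (ζ : Fin d → Circle) (w : Circle) :
    toComplex (joinLast ζ w) = joinLastC (toComplex ζ) w := by
  ext i
  refine Fin.lastCases ?_ (fun i => ?_) i <;> simp [toComplex]

theorem update_joinLastC (z : Fin d → ℂ) (w v : ℂ) :
    Function.update (joinLastC z w) (Fin.last d) v = joinLastC z v :=
  Fin.update_snoc_last (α := fun _ => ℂ) w z v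

theorem joinLastC_mem_closedPolydisk {z : Fin d → ℂ} {w : ℂ} (hz : z ∈ closedPolydisk d)
    (hw : ‖w‖ ≤ 1) : joinLastC z w ∈ closedPolydisk (d + 1) := by
  intro i
  refine Fin.lastCases ?_ (fun i => ?_) i
  · simpa using hw
  · simpa using hz i

theorem exists_eq_joinLastC (z : Fin (d + 1) → ℂ) : ∃ z' w, z = joinLastC z' w := by
  refine ⟨fun i => z i.castSucc, z (Fin.last d), ?_⟩
  ext i
  refine Fin.lastCases ?_ (fun i => ?_) i <;> simp

theorem update_mem_closedPolydisk {z : Fin d → ℂ} (hz : z ∈ closedPolydisk d) (j : Fin d) {w : ℂ}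
    (hw : ‖w‖ ≤ 1) : Function.update z j w ∈ closedPolydisk d := by
  intro i
  by_cases h : i = j
  · subst h
    simpa using hw
  · simpa [h] using hz i

theorem toComplex_mem_closedPolydisk (ζ : Fin d → Circle) : toComplex ζ ∈ closedPolydisk d :=
  fun i => (Circle.norm_coe (ζ i)).le

theorem polydisk_subset_closedPolydisk : polydisk d ⊆ closedPolydisk d := fun _ hz i => (hz i).le

theorem continuous_toComplex : Continuous (toComplex (d := d)) :=
  continuous_pi fun i => continuous_subtype_val.comp (continuous_apply i)

theorem contDiff_joinLastC {m : WithTop ℕ∞} :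
    ContDiff ℂ m fun x : (Fin d → ℂ) × ℂ => joinLastC x.1 x.2 := by
  rw [contDiff_pi]
  intro i
  refine Fin.lastCases ?_ (fun i => ?_) i
  · simpa using contDiff_snd
  · simp only [joinLastC_castSucc]
    fun_prop

theorem continuous_joinLastC : Continuous fun x : (Fin d → ℂ) × ℂ => joinLastC x.1 x.2 :=
  (contDiff_joinLastC (m := 0)).continuous

theorem continuous_joinLast : Continuous fun x : (Fin d → Circle) × Circle => joinLast x.1 x.2 := by
  refine continuous_pi fun i => ?_
  refine Fin.lastCases ?_ (fun i => ?_) i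
  · simpa using continuous_snd
  · simp only [joinLast_castSucc]
    fun_prop

end joinLast

section quotient

variable {d : ℕ} {p : MvPolynomial (Fin d) ℂ}

theorem analyticAt_quotientFun {z : Fin d → ℂ} (hz : eval z p ≠ 0) :
    AnalyticAt ℂ (quotientFun p) z :=
  (AnalyticOnNhd.eval_mvPolynomial (reflection p) z (Set.mem_univ z)).div
    (AnalyticOnNhd.eval_mvPolynomial p z (Set.mem_univ z)) hz

/-- When `p̃ / p` is continuous on the torus, the level set is the set on which it equals `α`. -/
theorem levelSet_quotientFun (hp : ∀ z ∈ closedPolydisk d, eval z p ≠ 0) (α : Circle) :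
    levelSet (quotientFun p) α = {ζ | quotientFun p (toComplex ζ) = α} := by
  have hc : Continuous fun ζ : Fin d → Circle => quotientFun p (toComplex ζ) := by
    rw [continuous_iff_continuousAt]
    intro ζ
    exact (analyticAt_quotientFun (hp _ (toComplex_mem_closedPolydisk ζ))).continuousAt.comp
      continuous_toComplex.continuousAt
  have hset : {ζ : Fin d → Circle | Tendsto (fun r : ℝ => quotientFun p fun j =>
      (r : ℂ) * (ζ j : ℂ)) (𝓝[<] 1) (𝓝 (α : ℂ))} = {ζ | quotientFun p (toComplex ζ) = α} := by
    ext ζ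
    have hlim : Tendsto (fun r : ℝ => quotientFun p fun j => (r : ℂ) * (ζ j : ℂ))
        (𝓝[<] 1) (𝓝 (quotientFun p (toComplex ζ))) := by
      have h1 : Continuous fun r : ℝ => fun j => (r : ℂ) * (ζ j : ℂ) := by fun_prop
      have h2 : (fun j => ((1 : ℝ) : ℂ) * (ζ j : ℂ)) = toComplex ζ := by
        ext j
        simp [toComplex]
      have h3 := (analyticAt_quotientFun
        (hp _ (toComplex_mem_closedPolydisk ζ))).continuousAt
      rw [← h2] at h3 ⊢
      exact (ContinuousAt.comp (f := fun r : ℝ => fun j => (r : ℂ) * (ζ j : ℂ)) h3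
        h1.continuousAt).tendsto.mono_left nhdsWithin_le_nhds
    simp only [Set.mem_ofPred_eq]
    exact ⟨fun h => tendsto_nhds_unique hlim h, fun h => h ▸ hlim⟩
  rw [levelSet, hset]
  exact (isClosed_eq hc continuous_const).closure_eq

end quotient

section slices

variable {d : ℕ} {p : MvPolynomial (Fin (d + 1)) ℂ}

/-- On every slice `{ζ'} × ℂ` with `ζ'` in the torus, `p̃ / p` is a finite Blaschke product of
degree `N`. -/
theorem isBlaschkePair_slice (hp : ∀ z ∈ closedPolydisk (d + 1), eval z p ≠ 0)
    (hpos : 0 < p.degreeOf (Fin.last d)) (ζ : Fin d → Circle) :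
    IsBlaschkePair (p.degreeOf (Fin.last d)) (∏ i : Fin d, (ζ i : ℂ) ^ p.degreeOf i.castSucc)
      (slice p (joinLastC (toComplex ζ) 0) (Fin.last d))
      (slice (reflection p) (joinLastC (toComplex ζ) 0) (Fin.last d)) where
  pos := hpos
  natDegree_le := natDegree_slice_le _ _ _
  natDegree_le' := (natDegree_slice_le _ _ _).trans (degreeOf_reflection_le _ _)
  norm_eq_one := by
    rw [norm_prod]
    refine Finset.prod_eq_one fun i _ => ?_
    rw [norm_pow, Circle.norm_coe, one_pow]
  eval_ne_zero w hw := by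
    rw [eval_slice, update_joinLastC]
    exact hp _ (joinLastC_mem_closedPolydisk (toComplex_mem_closedPolydisk ζ) hw)
  eval_eq w hw := by
    rw [eval_slice, eval_slice, update_joinLastC]
    obtain ⟨w, rfl⟩ : ∃ x : Circle, (x : ℂ) = w := ⟨⟨w, mem_sphere_zero_iff_norm.2 hw⟩, rfl⟩
    rw [← toComplex_joinLast, eval_reflection_toComplex, Fin.prod_univ_castSucc]
    simp

theorem eval_slice_div (ζ : Fin d → ℂ) (w : ℂ) :
    (slice (reflection p) (joinLastC ζ 0) (Fin.last d)).eval w /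
      (slice p (joinLastC ζ 0) (Fin.last d)).eval w = quotientFun p (joinLastC ζ w) := by
  rw [eval_slice, eval_slice, update_joinLastC, quotientFun]

theorem partialLast_joinLastC (ζ : Fin d → ℂ) (w : ℂ) :
    partialLast (quotientFun p) (joinLastC ζ w) = deriv (fun v =>
      (slice (reflection p) (joinLastC ζ 0) (Fin.last d)).eval v /
      (slice p (joinLastC ζ 0) (Fin.last d)).eval v) w := by
  simp only [partialLast, update_joinLastC, joinLastC_last, eval_slice_div]

theorem partialLast_ne_zero (hp : ∀ z ∈ closedPolydisk (d + 1), eval z p ≠ 0)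
    (hpos : 0 < p.degreeOf (Fin.last d)) (ζ : Fin (d + 1) → Circle) :
    partialLast (quotientFun p) (toComplex ζ) ≠ 0 := by
  rw [← joinLast_init_last ζ, toComplex_joinLast, partialLast_joinLastC]
  exact (isBlaschkePair_slice hp hpos _).deriv_ne_zero (Circle.norm_coe _)

theorem partialLast_eq_fderiv {φ : (Fin (d + 1) → ℂ) → ℂ} {z : Fin (d + 1) → ℂ}
    (h : DifferentiableAt ℂ φ z) :
    partialLast φ z = fderiv ℂ φ z (Pi.single (Fin.last d) 1) := by
  have h1 : HasDerivAt (Function.update z (Fin.last d)) (Pi.single (Fin.last d) (1 : ℂ))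
      (z (Fin.last d)) := hasDerivAt_update z (Fin.last d) _
  have h2 : HasFDerivAt φ (fderiv ℂ φ z)
      (Function.update z (Fin.last d) (z (Fin.last d))) := by
    rw [Function.update_eq_self]
    exact h.hasFDerivAt
  exact (h2.comp_hasDerivAt _ h1).deriv

theorem continuous_partialLast (hp : ∀ z ∈ closedPolydisk (d + 1), eval z p ≠ 0) :
    Continuous fun ζ : Fin (d + 1) → Circle => partialLast (quotientFun p) (toComplex ζ) := by
  rw [continuous_iff_continuousAt]
  intro ζ
  have ha := analyticAt_quotientFun (hp _ (toComplex_mem_closedPolydisk ζ))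
  have h1 : ContinuousAt (fun z => fderiv ℂ (quotientFun p) z (Pi.single (Fin.last d) 1))
      (toComplex ζ) := ha.fderiv.continuousAt.clm_apply continuousAt_const
  have h2 : ContinuousAt (fun z => partialLast (quotientFun p) z) (toComplex ζ) := by
    refine h1.congr ?_
    filter_upwards [ha.eventually_analyticAt] with z hz
    exact (partialLast_eq_fderiv hz.differentiableAt).symm
  exact h2.comp continuous_toComplex.continuousAt

/-- A continuous solution `w = g(ζ')` of `φ(ζ', w) = α` is analytic, by the implicit function
theorem. -/
theorem analyticAtTorus_of_continuousAt (hp : ∀ z ∈ closedPolydisk (d + 1), eval z p ≠ 0)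
    (hpos : 0 < p.degreeOf (Fin.last d)) {α : Circle} {g : (Fin d → Circle) → Circle}
    (hg : ∀ η, quotientFun p (joinLastC (toComplex η) (g η)) = α) {ζ : Fin d → Circle}
    (hc : ContinuousAt g ζ) : AnalyticAtTorus g ζ := by
  set f : (Fin d → ℂ) × ℂ → ℂ := fun x => quotientFun p (joinLastC x.1 x.2) with hf
  set u : (Fin d → ℂ) × ℂ := (toComplex ζ, (g ζ : ℂ)) with hu
  have ha : AnalyticAt ℂ (quotientFun p) (joinLastC u.1 u.2) :=
    analyticAt_quotientFun (hp _ (joinLastC_mem_closedPolydisk (toComplex_mem_closedPolydisk ζ)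
      (Circle.norm_coe _).le))
  have cdf : ContDiffAt ℂ ⊤ f u :=
    ContDiffAt.comp (g := quotientFun p) u ha.contDiffAt contDiff_joinLastC.contDiffAt
  have hne : (fderiv ℂ f u ∘L .inr ℂ (Fin d → ℂ) ℂ) 1 ≠ 0 := by
    have h1 : HasDerivAt (fun w : ℂ => (u.1, w)) ((0, 1) : (Fin d → ℂ) × ℂ) u.2 :=
      (hasDerivAt_const _ _).prodMk (hasDerivAt_id _)
    have h2 : HasFDerivAt f (fderiv ℂ f u) ((fun w : ℂ => (u.1, w)) u.2) :=
      (cdf.differentiableAt (by simp)).hasFDerivAt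
    have h3 := (h2.comp_hasDerivAt _ h1).deriv
    have h4 : partialLast (quotientFun p) (joinLastC (toComplex ζ) (g ζ)) =
        fderiv ℂ f u (0, 1) := by
      rw [← h3]
      simp only [partialLast, update_joinLastC, joinLastC_last]
      rfl
    simp only [ContinuousLinearMap.coe_comp, Function.comp_apply, ContinuousLinearMap.inr_apply]
    rw [← h4, ← toComplex_joinLast]
    exact partialLast_ne_zero hp hpos _
  have if₂ : (fderiv ℂ f u ∘L .inr ℂ (Fin d → ℂ) ℂ).IsInvertible := by
    set l : ℂ →L[ℂ] ℂ := fderiv ℂ f u ∘L .inr ℂ (Fin d → ℂ) ℂ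
    refine ⟨ContinuousLinearEquiv.unitsEquivAut ℂ (Units.mk0 (l 1) hne), ?_⟩
    ext
    simp
  refine ⟨cdf.implicitFunction (by simp) if₂, ?_, ?_⟩
  · exact (cdf.contDiffAt_implicitFunction (by simp) if₂).analyticAt
  · have ht : Tendsto (fun η : Fin d → Circle => (toComplex η, (g η : ℂ))) (𝓝 ζ) (𝓝 u) :=
      (continuous_toComplex.continuousAt).prodMk
        (continuous_subtype_val.continuousAt.comp hc)
    filter_upwards [ht.eventually
      (cdf.eventually_apply_eq_iff_implicitFunction (by simp) if₂)] with η hη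
    refine (hη.1 ?_).symm
    simp only [hf, hu]
    rw [hg, hg]

end slices

/-! ### Branches of the unimodular level set -/

/-- A continuous phase `Ψ` of a function `exp (i Ψ)` with logarithmic derivative `i ρ` at `t` has
derivative `ρ` at `t`. -/
theorem hasDerivAt_phase {Ψ : ℝ → ℝ} {t ρ : ℝ} (hΨ : ContinuousAt Ψ t)
    (h : HasDerivAt (fun s => Complex.exp (Ψ s * Complex.I))
      (ρ * Complex.I * Complex.exp (Ψ t * Complex.I)) t) : HasDerivAt Ψ ρ t := by
  have h0 : Complex.exp (Ψ t * Complex.I) ≠ 0 := Complex.exp_ne_zero _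
  have h1 : HasDerivAt (fun s => Complex.exp (Ψ s * Complex.I) / Complex.exp (Ψ t * Complex.I))
      (ρ * Complex.I) t := by
    have := h.div_const (Complex.exp (Ψ t * Complex.I))
    rwa [mul_div_cancel_right₀ _ h0] at this
  have h2 := h1.clog_real (by rw [div_self h0]; exact Complex.one_mem_slitPlane)
  rw [div_self h0, div_one] at h2
  have h3 : HasDerivAt (fun s => (Complex.log (Complex.exp (Ψ s * Complex.I) /
      Complex.exp (Ψ t * Complex.I))).im) ρ t := by
    have := Complex.imCLM.hasFDerivAt.comp_hasDerivAt t h2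
    have h4 : Complex.imCLM (ρ * Complex.I) = ρ := by simp
    rw [h4] at this
    exact this
  have h4 := h3.add_const (Ψ t)
  refine h4.congr_of_eventuallyEq ?_
  have h5 : ∀ᶠ s in 𝓝 t, Ψ s - Ψ t ∈ Set.Ioo (-Real.pi) Real.pi := by
    refine (hΨ.sub continuousAt_const).eventually_mem (Ioo_mem_nhds ?_ ?_) <;>
      simp [Real.pi_pos]
  filter_upwards [h5] with s hs
  rw [← Complex.exp_sub, Complex.log_exp]
  · simp
  · simpa using hs.1
  · simpa using hs.2.le

/-- If `f` commutes with the translation by `T` up to the constant `c`, then it commutes with the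
translation by `m T` up to `m c`, for every integer `m`. -/
theorem add_int_mul_of_add_period {f : ℝ → ℝ} {T c : ℝ} (hT : T ≠ 0)
    (h : ∀ t, f (t + T) = f t + c) (t : ℝ) (m : ℤ) : f (t + m * T) = f t + m * c := by
  have hper : Function.Periodic (fun t => f t - t * (c / T)) T := by
    intro t
    simp only [h]
    field_simp
    ring
  have : f (t + m * T) - (t + m * T) * (c / T) = f t - t * (c / T) := hper.int_mul m t
  have h2 : (m * T) * (c / T) = m * c := by field_simp
  linear_combination this + h2

/-- A continuous family of strictly increasing functions that commute with translations up to a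
positive constant has a continuous family of inverses. -/
theorem exists_continuous_inverse {X : Type*} [TopologicalSpace X] {Ψ : X → ℝ → ℝ}
    (hc : ∀ t, Continuous fun x => Ψ x t) (hc' : ∀ x, Continuous (Ψ x))
    (hm : ∀ x, StrictMono (Ψ x)) {T c : ℝ} (hT : T ≠ 0) (hc0 : 0 < c)
    (hper : ∀ x t, Ψ x (t + T) = Ψ x t + c) :
    ∃ S : X → ℝ → ℝ, (∀ x y, Ψ x (S x y) = y) ∧ ∀ y, Continuous fun x => S x y := by
  have hsurj : ∀ x y, ∃ t, Ψ x t = y := by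
    intro x y
    have h1 := fun m => add_int_mul_of_add_period hT (hper x) 0 m
    refine mem_range_of_exists_le_of_exists_ge (hc' x) ?_ ?_
    · refine ⟨0 + (⌊(y - Ψ x 0) / c⌋ : ℤ) * T, ?_⟩
      rw [h1]
      have := (le_div_iff₀ hc0).1 (Int.floor_le ((y - Ψ x 0) / c))
      linarith
    · refine ⟨0 + (⌈(y - Ψ x 0) / c⌉ : ℤ) * T, ?_⟩
      rw [h1]
      have := (div_le_iff₀ hc0).1 (Int.le_ceil ((y - Ψ x 0) / c))
      linarith
  choose S hS using hsurj
  refine ⟨S, hS, fun y => ?_⟩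
  rw [continuous_iff_continuousAt]
  intro x
  rw [ContinuousAt, tendsto_order]
  constructor
  · intro a ha
    have h1 : Ψ x a < y := by
      rw [← hS x y]
      exact hm x ha
    filter_upwards [(hc a).continuousAt.eventually_lt continuousAt_const h1] with x' hx'
    rw [← (hm x').lt_iff_lt, hS]
    exact hx'
  · intro a ha
    have h1 : y < Ψ x a := by
      rw [← hS x y]
      exact hm x ha
    filter_upwards [continuousAt_const.eventually_lt (hc a).continuousAt h1] with x' hx'
    rw [← (hm x').lt_iff_lt, hS]
    exact hx'

/-- A continuous logarithm of `p` on the closed polydisk. -/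
theorem exists_continuous_log {d : ℕ} {p : MvPolynomial (Fin d) ℂ}
    (hp : ∀ z ∈ closedPolydisk d, eval z p ≠ 0) :
    ∃ L : (Fin d → ℂ) → ℂ, Continuous L ∧
      ∀ z ∈ closedPolydisk d, Complex.exp (L z) = eval z p := by
  -- the coordinatewise radial retraction onto the closed polydisk
  set r : (Fin d → ℂ) → (Fin d → ℂ) := fun z i => z i / (max 1 ‖z i‖ : ℝ) with hr
  have hmax : ∀ (z : Fin d → ℂ) i, 0 < max 1 ‖z i‖ := fun z i => lt_max_of_lt_left one_pos
  have hrc : Continuous r := by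
    refine continuous_pi fun i => ?_
    refine (continuous_apply i).div (Complex.continuous_ofReal.comp
      (continuous_const.max (continuous_apply i).norm)) fun z => ?_
    exact_mod_cast (hmax z i).ne'
  have hrm : ∀ z, r z ∈ closedPolydisk d := by
    intro z i
    simp only [hr, norm_div, Complex.norm_real, Real.norm_of_nonneg (hmax z i).le]
    rw [div_le_one (hmax z i)]
    exact le_max_right _ _
  have hre : ∀ z ∈ closedPolydisk d, r z = z := by
    intro z hz
    ext i
    simp [hr, max_eq_left (hz i)]
  have hsc : IsSimplyConnected (Set.univ : Set (Fin d → ℂ)) := by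
    have := (Homeomorph.Set.univ (Fin d → ℂ)).contractibleSpace
    exact SimplyConnectedSpace.ofContractible _
  obtain ⟨L, hL, hLe⟩ := Complex.exists_continuousOn_eqOn_exp_comp (X := Fin d → ℂ)
    (U := Set.univ) (g := fun z => eval (r z) p)
    hsc isOpen_univ
    ((MvPolynomial.continuous_eval p).comp hrc).continuousOn
    (by rintro ⟨z, -, hz⟩; exact hp _ (hrm z) hz)
  refine ⟨L, continuousOn_univ.1 hL, fun z hz => ?_⟩
  have := hLe (Set.mem_univ z)
  simp only [Function.comp_apply, hre z hz] at this
  exact this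

section branches

variable {d : ℕ} {p : MvPolynomial (Fin (d + 1)) ℂ}

/-- A continuous phase of `p̃ / p` in the angles. If `L` is a continuous logarithm of `p`, then
`p̃ / p = ζⁿ exp (-2 i Im L)` on the torus, so `Ψ = ∑ nᵢ θᵢ - 2 Im L` will do. -/
theorem exists_phase (hp : ∀ z ∈ closedPolydisk (d + 1), eval z p ≠ 0)
    (hpos : 0 < p.degreeOf (Fin.last d)) :
    ∃ Ψ : (Fin d → ℝ) → ℝ → ℝ, (∀ t, Continuous fun θ => Ψ θ t) ∧ (∀ θ, StrictMono (Ψ θ)) ∧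
      (∀ θ, Continuous (Ψ θ)) ∧
      (∀ θ t, Ψ θ (t + 2 * Real.pi) = Ψ θ t + p.degreeOf (Fin.last d) * (2 * Real.pi)) ∧
      ∀ θ t, quotientFun p (joinLastC (toComplex fun i => Circle.exp (θ i)) (Circle.exp t)) =
        Circle.exp (Ψ θ t) := by
  obtain ⟨L, hL, hLe⟩ := exists_continuous_log hp
  set e : (Fin d → ℝ) → Fin d → Circle := fun θ i => Circle.exp (θ i) with he
  have hec : Continuous e := continuous_pi fun i =>
    Circle.exp.continuous.comp (continuous_apply i)
  set Z : (Fin d → ℝ) → ℝ → Fin (d + 1) → ℂ :=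
    fun θ t => joinLastC (toComplex (e θ)) (Circle.exp t) with hZ
  have hZc : Continuous fun x : (Fin d → ℝ) × ℝ => Z x.1 x.2 :=
    continuous_joinLastC.comp (((continuous_toComplex.comp hec).comp continuous_fst).prodMk
      (continuous_subtype_val.comp (Circle.exp.continuous.comp continuous_snd)))
  set Ψ : (Fin d → ℝ) → ℝ → ℝ := fun θ t => ∑ i : Fin d, p.degreeOf i.castSucc * θ i +
    p.degreeOf (Fin.last d) * t - 2 * (L (Z θ t)).im with hΨ
  have hΨc : Continuous fun x : (Fin d → ℝ) × ℝ => Ψ x.1 x.2 := by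
    have := Complex.continuous_im.comp (hL.comp hZc)
    simp only [hΨ]
    refine (Continuous.add (by fun_prop) (by fun_prop)).sub (this.const_mul 2)
  have hφ : ∀ θ t, quotientFun p (Z θ t) = Circle.exp (Ψ θ t) := by
    intro θ t
    have hz : Z θ t = toComplex (joinLast (e θ) (Circle.exp t)) := (toComplex_joinLast _ _).symm
    have hl := hLe (Z θ t) (by rw [hz]; exact toComplex_mem_closedPolydisk _)
    rw [quotientFun, ← hl, hz, eval_reflection_toComplex, ← hz, ← hl, Fin.prod_univ_castSucc,
      ← Complex.exp_conj, mul_div_assoc, ← Complex.exp_sub]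
    have h1 : conj (L (Z θ t)) - L (Z θ t) = ((-(2 * (L (Z θ t)).im) : ℝ) : ℂ) * Complex.I := by
      apply Complex.ext <;> simp
      ring
    rw [h1, Circle.coe_exp]
    simp only [joinLast_castSucc, joinLast_last, he, Circle.coe_exp, hΨ, ← Complex.exp_nat_mul,
      ← Complex.exp_sum, ← Complex.exp_add]
    congr 1
    push_cast
    rw [sub_eq_add_neg, add_mul, add_mul, Finset.sum_mul]
    simp only [mul_assoc]
  have hΨc' : ∀ θ, Continuous (Ψ θ) := fun θ =>
    hΨc.comp (continuous_const.prodMk continuous_id)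
  refine ⟨Ψ, fun t => hΨc.comp (continuous_id.prodMk continuous_const), fun θ => ?_, hΨc',
    fun θ t => ?_, hφ⟩
  · have hB := isBlaschkePair_slice hp hpos (e θ)
    set q := slice p (joinLastC (toComplex (e θ)) 0) (Fin.last d)
    set q' := slice (reflection p) (joinLastC (toComplex (e θ)) 0) (Fin.last d)
    refine strictMono_of_hasDerivAt_pos (f' := fun t => p.degreeOf (Fin.last d) -
      2 * (Circle.exp t * (q.derivative.eval (Circle.exp t : ℂ) /
        q.eval (Circle.exp t : ℂ))).re) (fun t => ?_)
      fun t => hB.angular_pos (Circle.norm_coe _)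
    refine hasDerivAt_phase (hΨc' θ).continuousAt ?_
    have hb : ∀ s : ℝ, Complex.exp (Ψ θ s * Complex.I) =
        q'.eval (Complex.exp (s * Complex.I)) / q.eval (Complex.exp (s * Complex.I)) := by
      intro s
      rw [← Circle.coe_exp, ← Circle.coe_exp, eval_slice_div]
      exact (hφ θ s).symm
    have hexp := hasDerivAt_exp_mul_I t
    have hn : ‖Complex.exp (t * Complex.I)‖ = 1 := Complex.norm_exp_ofReal_mul_I t
    have h2 := (hB.hasDerivAt hn.le).differentiableAt.hasDerivAt.comp t hexp
    have h3 := hB.mul_deriv_eq hn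
    rw [funext hb]
    refine h2.congr_deriv ?_
    rw [Circle.coe_exp, hb]
    linear_combination Complex.I * h3
  · have h1 : Circle.exp (t + 2 * Real.pi) = Circle.exp t := Circle.exp_add_two_pi t
    simp only [hΨ, hZ, h1]
    ring

/-- Over the universal cover `ℝᵈ` of the torus, the solutions `w` of `φ(ζ', w) = α` are given by
`N` continuous angles, which are pairwise distinct modulo `2π`. -/
theorem exists_branches (hp : ∀ z ∈ closedPolydisk (d + 1), eval z p ≠ 0)
    (hpos : 0 < p.degreeOf (Fin.last d)) (α : Circle) :
    ∃ t : Fin (p.degreeOf (Fin.last d)) → (Fin d → ℝ) → ℝ, (∀ k, Continuous (t k)) ∧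
      (∀ θ, Function.Injective fun k => Circle.exp (t k θ)) ∧
      ∀ θ (w : Circle), quotientFun p (joinLastC (toComplex fun i => Circle.exp (θ i)) w) = α ↔
        ∃ k, w = Circle.exp (t k θ) := by
  obtain ⟨Ψ, hc, hm, hc', hper, hφ⟩ := exists_phase hp hpos
  set n := p.degreeOf (Fin.last d) with hn
  have hn0 : (0 : ℝ) < n := by exact_mod_cast hpos
  have hpi : 2 * Real.pi ≠ 0 := Real.two_pi_pos.ne'
  obtain ⟨S, hS, hSc⟩ := exists_continuous_inverse hc hc' hm hpi (by positivity) hper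
  obtain ⟨a, rfl⟩ := Circle.exp_surjective α
  refine ⟨fun k θ => S θ (a + k.val * (2 * Real.pi)), fun k => hSc _, fun θ k l hkl => ?_,
    fun θ w => ?_⟩
  · obtain ⟨m, hm'⟩ := Circle.exp_eq_exp.1 hkl
    have h1 := congrArg (Ψ θ) hm'
    rw [add_int_mul_of_add_period hpi (hper θ), hS, hS] at h1
    have h2 : ((k : ℕ) : ℝ) = (l : ℕ) + m * n :=
      mul_right_cancel₀ hpi (by linear_combination h1)
    have h3 : ((k : ℕ) : ℤ) = (l : ℕ) + m * n := by exact_mod_cast h2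
    have h4 := congrArg (· % (n : ℤ)) h3
    simp only [Int.add_mul_emod_self_right] at h4
    rw [Int.emod_eq_of_lt (by positivity) (by exact_mod_cast k.2),
      Int.emod_eq_of_lt (by positivity) (by exact_mod_cast l.2)] at h4
    exact Fin.ext (by exact_mod_cast h4)
  · constructor
    · intro h
      obtain ⟨t, rfl⟩ := Circle.exp_surjective w
      rw [hφ] at h
      obtain ⟨m, hm'⟩ := Circle.exp_eq_exp.1 (Subtype.coe_injective h)
      -- if the phases differ by `2π m`, then `w` lies on the branch with index `m mod n`
      have hnz : (0 : ℤ) < n := by exact_mod_cast hpos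
      have hk0 := Int.emod_nonneg m hnz.ne'
      have hkn := Int.emod_lt_of_pos m hnz
      refine ⟨⟨(m % n).toNat, by omega⟩, ?_⟩
      rw [Circle.exp_eq_exp]
      refine ⟨m / n, (hm θ).injective ?_⟩
      rw [add_int_mul_of_add_period hpi (hper θ), hS, hm']
      have h5 : (((m % n).toNat : ℕ) : ℝ) = ((m % n : ℤ) : ℝ) := by
        exact_mod_cast Int.toNat_of_nonneg hk0
      have h6 : (m : ℝ) = ((m % n : ℤ) : ℝ) + n * ((m / n : ℤ) : ℝ) := by
        exact_mod_cast (Int.emod_add_mul_ediv m n).symm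
      simp only [h5]
      linear_combination (2 * Real.pi) * h6
    · rintro ⟨k, rfl⟩
      rw [hφ, hS]
      have h7 : Circle.exp (a + k.val * (2 * Real.pi)) = Circle.exp a :=
        Circle.exp_eq_exp.2 ⟨k.val, by push_cast; ring⟩
      rw [h7]

/-- The branches, pulled back to the torus by angles that are continuous off the cuts, parametrize
the level set. -/
theorem exists_isParametrization (hp : ∀ z ∈ closedPolydisk (d + 1), eval z p ≠ 0)
    (hpos : 0 < p.degreeOf (Fin.last d)) (α : Circle) (τ : Fin d → Circle) :
    ∃ g : Fin (p.degreeOf (Fin.last d)) → (Fin d → Circle) → Circle,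
      IsParametrization (quotientFun p) α τ g := by
  obtain ⟨t, htc, -, ht⟩ := exists_branches hp hpos α
  -- angles that jump exactly at the cuts: the argument of `ζᵢ` relative to the base point `-τᵢ`
  set b : Fin d → ℝ := fun i => Complex.arg (τ i) + Real.pi with hb
  set θ : (Fin d → Circle) → Fin d → ℝ :=
    fun ζ i => b i + Complex.arg ((ζ i * (Circle.exp (b i))⁻¹ : Circle) : ℂ) with hθ
  have hθe : ∀ ζ, (fun i => Circle.exp (θ ζ i)) = ζ := by
    intro ζ
    ext i
    simp only [hθ, Circle.exp_add, Circle.exp_arg]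
    rw [mul_comm, inv_mul_cancel_right]
  have hroot : ∀ ζ (w : Circle), quotientFun p (joinLastC (toComplex ζ) w) = α ↔
      ∃ k, w = Circle.exp (t k (θ ζ)) := by
    intro ζ w
    have := ht (θ ζ) w
    rwa [hθe] at this
  have hθc : ∀ ζ, (∀ i, ζ i ≠ τ i) → ContinuousAt θ ζ := by
    intro ζ hζ
    refine continuousAt_pi.2 fun i => ?_
    refine continuousAt_const.add ?_
    have hslit : ((ζ i * (Circle.exp (b i))⁻¹ : Circle) : ℂ) ∈ Complex.slitPlane := by
      rw [Complex.mem_slitPlane_iff_arg]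
      refine ⟨fun h => hζ i ?_, Circle.coe_ne_zero _⟩
      have h1 := Circle.exp_arg (ζ i * (Circle.exp (b i))⁻¹)
      rw [h, eq_mul_inv_iff_mul_eq, ← Circle.exp_add] at h1
      rw [← h1, ← Circle.exp_arg (τ i), Circle.exp_eq_exp]
      exact ⟨1, by simp only [hb, Int.cast_one]; ring⟩
    refine ContinuousAt.comp (g := Complex.arg)
      (f := fun ζ : Fin d → Circle => ((ζ i * (Circle.exp (b i))⁻¹ : Circle) : ℂ))
      (Complex.continuousAt_arg hslit) ?_
    exact (continuous_subtype_val.comp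
      ((continuous_apply i).mul continuous_const)).continuousAt
  refine ⟨fun k ζ => Circle.exp (t k (θ ζ)), ?_, ?_⟩
  · intro k ζ hζ
    refine analyticAtTorus_of_continuousAt hp hpos (α := α) (fun η => (hroot η _).2 ⟨k, rfl⟩) ?_
    exact Circle.exp.continuous.continuousAt.comp
      ((htc k).continuousAt.comp (hθc ζ hζ))
  · rw [levelSet_quotientFun hp]
    ext ζ
    rw [Set.mem_ofPred_eq, Set.mem_iUnion]
    constructor
    · intro h
      rw [← joinLast_init_last ζ, toComplex_joinLast, hroot] at h
      obtain ⟨k, hk⟩ := h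
      refine ⟨k, fun i => ζ i.castSucc, ?_⟩
      simp only
      rw [← hk, joinLast_init_last]
    · rintro ⟨k, ζ', rfl⟩
      rw [toComplex_joinLast, hroot]
      exact ⟨k, rfl⟩

/-- The values of a parametrization over `ζ'` are the solutions `w` of `φ(ζ', w) = α`. -/
theorem IsParametrization.eq_iff (hp : ∀ z ∈ closedPolydisk (d + 1), eval z p ≠ 0)
    {N : ℕ} {α : Circle} {τ : Fin d → Circle} {g : Fin N → (Fin d → Circle) → Circle}
    (hg : IsParametrization (quotientFun p) α τ g) (ζ : Fin d → Circle) (w : Circle) :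
    quotientFun p (joinLastC (toComplex ζ) w) = α ↔ ∃ j, g j ζ = w := by
  have h := Set.ext_iff.1 hg.levelSet_eq (joinLast ζ w)
  rw [levelSet_quotientFun hp, Set.mem_ofPred_eq, toComplex_joinLast, Set.mem_iUnion] at h
  rw [h]
  refine exists_congr fun j => ⟨?_, ?_⟩
  · rintro ⟨ζ', hζ'⟩
    have h1 : ζ' = ζ := by
      ext i
      have := congrFun hζ' i.castSucc
      simp only [joinLast_castSucc] at this
      rw [this]
    subst h1
    simpa using congrFun hζ' (Fin.last d)
  · rintro rfl
    exact ⟨ζ, rfl⟩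

/-- There are exactly `N` solutions, so the `N` functions of a parametrization have distinct
values at every point. -/
theorem IsParametrization.injective (hp : ∀ z ∈ closedPolydisk (d + 1), eval z p ≠ 0)
    (hpos : 0 < p.degreeOf (Fin.last d)) {α : Circle} {τ : Fin d → Circle}
    {g : Fin (p.degreeOf (Fin.last d)) → (Fin d → Circle) → Circle}
    (hg : IsParametrization (quotientFun p) α τ g) (ζ : Fin d → Circle) :
    Function.Injective fun j => g j ζ := by
  obtain ⟨t, -, hinj, ht⟩ := exists_branches hp hpos α
  choose θ hθ using fun i => Circle.exp_surjective (ζ i)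
  have hθ' : (fun i => Circle.exp (θ i)) = ζ := funext hθ
  have hex : ∀ k, ∃ j, g j ζ = Circle.exp (t k θ) := by
    intro k
    rw [← hg.eq_iff hp, ← hθ']
    exact (ht θ _).2 ⟨k, rfl⟩
  choose σ hσ using hex
  have hσinj : Function.Injective σ := by
    intro k l hkl
    apply hinj θ
    simp only
    rw [← hσ k, ← hσ l, hkl]
  have hσb : Function.Bijective σ := Finite.injective_iff_bijective.1 hσinj
  intro i j hij
  obtain ⟨k, rfl⟩ := hσb.2 i
  obtain ⟨l, rfl⟩ := hσb.2 j
  simp only [hσ] at hij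
  rw [hinj θ hij]

end branches

/-! ### Poisson integrals on the torus -/

instance (d : ℕ) : IsProbabilityMeasure (torusMeasure d) := by
  unfold torusMeasure
  infer_instance

theorem integrable_of_continuous {X : Type*} [TopologicalSpace X] [CompactSpace X]
    [MeasurableSpace X] [OpensMeasurableSpace X] {μ : Measure X} [IsFiniteMeasure μ]
    {E : Type*} [NormedAddCommGroup E] [SecondCountableTopologyEither X E] {f : X → E}
    (hf : Continuous f) : Integrable f μ :=
  hf.integrable_of_hasCompactSupport (HasCompactSupport.of_compactSpace f)

theorem integral_arcLength {F : ℂ → ℂ} (hF : Continuous fun ζ : Circle => F ζ) :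
    ∫ ζ : Circle, F ζ ∂arcLength = Real.circleAverage F 0 1 := by
  rw [arcLength, integral_smul_measure,
    integral_map Circle.exp.continuous.aemeasurable hF.aestronglyMeasurable,
    Real.circleAverage_def, intervalIntegral.integral_of_le Real.two_pi_pos.le]
  congr 1
  · rw [ENNReal.toReal_inv, ENNReal.toReal_ofReal Real.two_pi_pos.le]
  · refine integral_congr_ae (Eventually.of_forall fun t => ?_)
    simp [circleMap]

/-- The one-variable Poisson kernel of the unit disk. -/
noncomputable def diskPoisson (z : ℂ) (ζ : Circle) : ℝ := (1 - ‖z‖ ^ 2) / ‖(ζ : ℂ) - z‖ ^ 2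

theorem polyPoisson_eq_prod {d : ℕ} (z : Fin d → ℂ) (ζ : Fin d → Circle) :
    polyPoisson z ζ = ∏ j, diskPoisson (z j) (ζ j) := rfl

theorem circle_sub_ne_zero (ζ : Circle) {z : ℂ} (hz : ‖z‖ < 1) : (ζ : ℂ) - z ≠ 0 := by
  intro h
  rw [← sub_eq_zero.1 h, Circle.norm_coe] at hz
  exact lt_irrefl _ hz

theorem continuous_diskPoisson_comp {X : Type*} [TopologicalSpace X] {z : X → ℂ} {ζ : X → Circle}
    (hz : Continuous z) (hζ : Continuous ζ) (h : ∀ x, ‖z x‖ < 1) :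
    Continuous fun x => diskPoisson (z x) (ζ x) := by
  unfold diskPoisson
  have hζ' : Continuous fun x => (ζ x : ℂ) := continuous_subtype_val.comp hζ
  refine Continuous.div (by fun_prop) (by fun_prop) fun x => ?_
  exact pow_ne_zero _ (norm_ne_zero_iff.2 (circle_sub_ne_zero _ (h x)))

theorem continuous_polyPoisson_comp {d : ℕ} {X : Type*} [TopologicalSpace X] {z : X → Fin d → ℂ}
    {ζ : X → Fin d → Circle} (hz : Continuous z) (hζ : Continuous ζ) (h : ∀ x, z x ∈ polydisk d) :
    Continuous fun x => polyPoisson (z x) (ζ x) :=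
  continuous_finsetProd _ fun j _ => continuous_diskPoisson_comp
    ((continuous_apply j).comp hz) ((continuous_apply j).comp hζ) fun x => h x j

theorem continuous_polyPoisson {d : ℕ} {z : Fin d → ℂ} (hz : z ∈ polydisk d) :
    Continuous (polyPoisson z) :=
  continuous_polyPoisson_comp continuous_const continuous_id fun _ => hz

theorem polyPoisson_joinLast {d : ℕ} (z : Fin d → ℂ) (w : ℂ) (ζ : Fin d → Circle) (ω : Circle) :
    polyPoisson (joinLastC z w) (joinLast ζ ω) = polyPoisson z ζ * diskPoisson w ω := by
  simp [polyPoisson_eq_prod, Fin.prod_univ_castSucc]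

theorem polyPoisson_nonneg {d : ℕ} {z : Fin d → ℂ} (hz : z ∈ polydisk d) (ζ : Fin d → Circle) :
    0 ≤ polyPoisson z ζ := by
  refine Finset.prod_nonneg fun j _ => div_nonneg ?_ (by positivity)
  have := hz j
  have := norm_nonneg (z j)
  nlinarith

/-- The Poisson integral formula in the unit disk. -/
theorem integral_diskPoisson_mul {F : ℂ → ℂ} (hF : DiffContOnCl ℂ F (Metric.ball 0 1)) {w : ℂ}
    (hw : ‖w‖ < 1) : ∫ ζ : Circle, (diskPoisson w ζ : ℂ) * F ζ ∂arcLength = F w := by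
  have hc : Continuous fun ζ : Circle => F ζ := by
    refine hF.continuousOn.comp_continuous continuous_subtype_val fun ζ => ?_
    rw [closure_ball _ one_ne_zero, mem_closedBall_zero_iff]
    exact (Circle.norm_coe ζ).le
  have h1 : (fun ζ : Circle => (diskPoisson w ζ : ℂ) * F ζ) =
      fun ζ : Circle => (poissonKernel 0 w • F) ζ := by
    ext ζ
    simp only [poissonKernel_def, diskPoisson, sub_zero, Pi.smul_apply', Complex.real_smul]
    rw [Circle.norm_coe, one_pow]
  have h2 := continuous_diskPoisson_comp (X := Circle) continuous_const continuous_id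
    (z := fun _ => w) fun _ => hw
  rw [h1, integral_arcLength]
  · exact hF.circleAverage_poissonKernel_smul (mem_ball_zero_iff.2 hw)
  · rw [← h1]
    exact (Complex.continuous_ofReal.comp h2).mul hc

/-- Fubini on `𝕋ᵈ⁺¹ = 𝕋ᵈ × 𝕋`. -/
theorem integral_torusMeasure_succ {d : ℕ} {f : (Fin (d + 1) → Circle) → ℂ} (hf : Continuous f) :
    ∫ ζ, f ζ ∂torusMeasure (d + 1) =
      ∫ ω, ∫ ζ', f (joinLast ζ' ω) ∂torusMeasure d ∂arcLength := by
  have hmp := (measurePreserving_piFinSuccAbove (α := fun _ : Fin (d + 1) => Circle)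
    (fun _ => arcLength) (Fin.last d)).symm
  have h := hmp.integral_comp' f
  have hc : Continuous fun x : Circle × (Fin d → Circle) => f (joinLast x.2 x.1) :=
    hf.comp (continuous_joinLast.comp (continuous_snd.prodMk continuous_fst))
  have hint : Integrable (fun x : Circle × (Fin d → Circle) => f (joinLast x.2 x.1))
      (arcLength.prod (torusMeasure d)) := integrable_of_continuous hc
  rw [← integral_prod _ hint, torusMeasure, ← h]
  refine integral_congr_ae (Eventually.of_forall fun x => ?_)
  exact congrArg f (Fin.insertNth_last' (β := Circle) x.1 x.2)

/-- The Poisson integral formula in the polydisk, for functions that are continuous on the closed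
polydisk and holomorphic in each variable. -/
theorem integral_polyPoisson_mul {d : ℕ} {F : (Fin d → ℂ) → ℂ}
    (hF : ContinuousOn F (closedPolydisk d))
    (hF' : ∀ z ∈ closedPolydisk d, ∀ j,
      DifferentiableOn ℂ (fun w => F (Function.update z j w)) (Metric.ball 0 1))
    {z : Fin d → ℂ} (hz : z ∈ polydisk d) :
    ∫ ζ, (polyPoisson z ζ : ℂ) * F (toComplex ζ) ∂torusMeasure d = F z := by
  induction d with
  | zero =>
    have h1 : ∀ ζ : Fin 0 → Circle, toComplex ζ = z := fun ζ => Subsingleton.elim _ _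
    simp [h1, polyPoisson]
  | succ d ih =>
    obtain ⟨z', w, rfl⟩ := exists_eq_joinLastC z
    have hz' : z' ∈ polydisk d := fun i => by simpa using hz i.castSucc
    have hw : ‖w‖ < 1 := by simpa using hz (Fin.last d)
    have hc : Continuous fun ζ : Fin (d + 1) → Circle =>
        (polyPoisson (joinLastC z' w) ζ : ℂ) * F (toComplex ζ) :=
      (Complex.continuous_ofReal.comp (continuous_polyPoisson hz)).mul
        (hF.comp_continuous continuous_toComplex toComplex_mem_closedPolydisk)
    rw [integral_torusMeasure_succ hc]
    have hinner : ∀ ω : Circle, ∫ ζ', (polyPoisson (joinLastC z' w) (joinLast ζ' ω) : ℂ) *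
        F (toComplex (joinLast ζ' ω)) ∂torusMeasure d =
          (diskPoisson w ω : ℂ) * F (joinLastC z' ω) := by
      intro ω
      have hG : ContinuousOn (fun x => F (joinLastC x (ω : ℂ))) (closedPolydisk d) :=
        hF.comp (continuous_joinLastC.comp
          (continuous_id.prodMk continuous_const)).continuousOn
          fun x hx => joinLastC_mem_closedPolydisk hx (Circle.norm_coe ω).le
      have hG' : ∀ x ∈ closedPolydisk d, ∀ j, DifferentiableOn ℂ
          (fun v => F (joinLastC (Function.update x j v) (ω : ℂ))) (Metric.ball 0 1) := by
        intro x hx j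
        have := hF' _ (joinLastC_mem_closedPolydisk hx (Circle.norm_coe ω).le) j.castSucc
        refine this.congr fun v _ => ?_
        congr 1
        exact Fin.snoc_update (α := fun _ => ℂ) (ω : ℂ) x j v
      rw [← ih hG hG' hz', ← integral_const_mul]
      refine integral_congr_ae (Eventually.of_forall fun ζ' => ?_)
      simp only [polyPoisson_joinLast, toComplex_joinLast]
      push_cast
      ring
    simp_rw [hinner]
    refine integral_diskPoisson_mul (F := fun v => F (joinLastC z' v)) ⟨?_, ?_⟩ hw
    · have := hF' (joinLastC z' 0) (joinLastC_mem_closedPolydisk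
        (polydisk_subset_closedPolydisk hz') (by simp)) (Fin.last d)
      simpa only [update_joinLastC] using this
    · rw [closure_ball _ one_ne_zero]
      exact hF.comp (continuous_joinLastC.comp
        (continuous_const.prodMk continuous_id)).continuousOn fun v hv =>
          joinLastC_mem_closedPolydisk (polydisk_subset_closedPolydisk hz')
            (mem_closedBall_zero_iff.1 hv)

/-! ### Uniqueness of measures with a given Poisson integral -/

/-- The character `ζᵏ` of the torus. -/
noncomputable def character {d : ℕ} (k : Fin d → ℤ) :
    BoundedContinuousFunction (Fin d → Circle) ℂ :=
  BoundedContinuousFunction.mkOfCompact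
    ⟨fun ζ => ∏ j, (ζ j : ℂ) ^ k j, continuous_finsetProd _ fun j _ =>
      (continuous_subtype_val.comp (continuous_apply j)).zpow₀ (k j)
        fun ζ => Or.inl (Circle.coe_ne_zero (ζ j))⟩

theorem character_apply {d : ℕ} (k : Fin d → ℤ) (ζ : Fin d → Circle) :
    character k ζ = ∏ j, (ζ j : ℂ) ^ k j := rfl

/-- Finite measures on the torus with the same Fourier coefficients are equal. -/
theorem measure_ext_of_integral_character {d : ℕ} {μ ν : Measure (Fin d → Circle)}
    [IsFiniteMeasure μ] [IsFiniteMeasure ν]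
    (h : ∀ k : Fin d → ℤ, ∫ ζ, character k ζ ∂μ = ∫ ζ, character k ζ ∂ν) : μ = ν := by
  let A : StarSubalgebra ℂ (BoundedContinuousFunction (Fin d → Circle) ℂ) :=
    { toSubalgebra := Algebra.adjoin ℂ (Set.range character)
      star_mem' := by
        change Algebra.adjoin ℂ (Set.range character) ≤
          star (Algebra.adjoin ℂ (Set.range character))
        refine Algebra.adjoin_le ?_
        rintro _ ⟨k, rfl⟩
        refine Algebra.subset_adjoin ⟨-k, ?_⟩
        ext ζ
        rw [BoundedContinuousFunction.star_apply, character_apply, character_apply,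
          RCLike.star_def, map_prod]
        refine Finset.prod_congr rfl fun j _ => ?_
        rw [map_zpow₀, ← Circle.coe_inv_eq_conj, Circle.coe_inv, inv_zpow, Pi.neg_apply,
          zpow_neg] }
  have hA : A.toSubalgebra.toSubmodule = Submodule.span ℂ (Set.range character) := by
    apply Algebra.adjoin_eq_span_of_subset
    refine .trans (fun x => Submonoid.closure_induction (fun _ => id) ⟨0, ?_⟩ ?_)
      Submodule.subset_span
    · ext ζ
      simp [character_apply]
    · rintro _ _ _ _ ⟨m, rfl⟩ ⟨n, rfl⟩
      refine ⟨m + n, ?_⟩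
      ext ζ
      simp [character_apply, zpow_add₀, Circle.coe_ne_zero, Finset.prod_mul_distrib]
  refine ext_of_forall_mem_subalgebra_integral_eq_of_polish (A := A) ?_ ?_
  · intro x y hxy
    obtain ⟨i, hi⟩ := Function.ne_iff.1 hxy
    refine ⟨_, ⟨_, ⟨character (Pi.single i 1), Algebra.subset_adjoin ⟨_, rfl⟩, rfl⟩, rfl⟩, ?_⟩
    have hs : ∀ ζ : Fin d → Circle, character (Pi.single i 1) ζ = (ζ i : ℂ) := by
      intro ζ
      rw [character_apply, Finset.prod_eq_single i]
      · simp
      · intro j _ hj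
        simp [hj]
      · simp
    change character (Pi.single i 1) x ≠ character (Pi.single i 1) y
    rw [hs, hs]
    exact fun h => hi (Subtype.coe_injective h)
  · intro g hg
    have hg' : g ∈ Submodule.span ℂ (Set.range (character (d := d))) := by
      rw [← hA]
      exact hg
    induction hg' using Submodule.span_induction with
    | mem x hx =>
      obtain ⟨k, rfl⟩ := hx
      exact h k
    | zero => simp
    | add x y hx hy h1 h2 =>
      have hx' : x ∈ A := by
        change x ∈ A.toSubalgebra.toSubmodule
        rwa [hA]
      have hy' : y ∈ A := by
        change y ∈ A.toSubalgebra.toSubmodule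
        rwa [hA]
      simp only [BoundedContinuousFunction.coe_add, Pi.add_apply]
      rw [integral_add (x.integrable _) (y.integrable _),
        integral_add (x.integrable _) (y.integrable _), h1 hx', h2 hy']
    | smul a x hx h1 =>
      have hx' : x ∈ A := by
        change x ∈ A.toSubalgebra.toSubmodule
        rwa [hA]
      simp only [BoundedContinuousFunction.coe_smul]
      rw [integral_smul, integral_smul, h1 hx']

/-- The Poisson integral of `ηᵏ` at `r ζ` is `r^|k| ζᵏ`; for `k < 0`, conjugate the formula for
`-k`. -/
theorem integral_diskPoisson_mul_zpow {r : ℝ} (hr : r ∈ Set.Ioo (0 : ℝ) 1) (ζ : Circle) (k : ℤ) :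
    ∫ η : Circle, (diskPoisson (r * ζ) η : ℂ) * (η : ℂ) ^ k ∂arcLength =
      (r : ℂ) ^ k.natAbs * (ζ : ℂ) ^ k := by
  have hw : ‖(r : ℂ) * ζ‖ < 1 := by
    rw [norm_mul, Circle.norm_coe, mul_one, Complex.norm_real, Real.norm_of_nonneg hr.1.le]
    exact hr.2
  have hnat : ∀ m : ℕ, ∫ η : Circle, (diskPoisson (r * ζ) η : ℂ) * (η : ℂ) ^ m ∂arcLength =
      (r : ℂ) ^ m * (ζ : ℂ) ^ m := by
    intro m
    rw [integral_diskPoisson_mul (F := fun w => w ^ m)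
      (Differentiable.diffContOnCl (by fun_prop)) hw, mul_pow]
  obtain ⟨m, rfl | rfl⟩ := Int.eq_nat_or_neg k
  · simpa using hnat m
  · have h1 := congrArg conj (hnat m)
    rw [← integral_conj] at h1
    simp only [map_mul, map_pow, Complex.conj_ofReal, ← Circle.coe_inv_eq_conj,
      Circle.coe_inv] at h1
    simpa using h1

/-- `P_{rη}(ζ) = P_{rζ}(η)`, because `ζ - r η = ζ η conj (η - r ζ)` on the circle. -/
theorem diskPoisson_symm (r : ℝ) (ζ η : Circle) :
    diskPoisson (r * η) ζ = diskPoisson (r * ζ) η := by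
  have h1 : ‖(ζ : ℂ) - r * η‖ = ‖(η : ℂ) - r * ζ‖ := by
    rw [← Complex.norm_conj, ← one_mul ‖conj _‖, ← Circle.norm_coe (ζ * η), ← norm_mul]
    congr 1
    simp only [map_sub, map_mul, Complex.conj_ofReal, ← Circle.coe_inv_eq_conj, Circle.coe_inv,
      Circle.coe_mul]
    have := Circle.coe_ne_zero ζ
    have := Circle.coe_ne_zero η
    field_simp
  rw [diskPoisson, diskPoisson, h1, norm_mul, norm_mul, Circle.norm_coe, Circle.norm_coe]

/-- A finite measure on the torus is determined by its Poisson integral. The Fourier coefficients of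
the Poisson integral on the torus of radius `r` are those of the measure, multiplied by `r^|k|`. -/
theorem measure_ext_of_integral_polyPoisson {d : ℕ} {μ ν : Measure (Fin d → Circle)}
    [IsFiniteMeasure μ] [IsFiniteMeasure ν]
    (h : ∀ z ∈ polydisk d, ∫ ζ, polyPoisson z ζ ∂μ = ∫ ζ, polyPoisson z ζ ∂ν) : μ = ν := by
  refine measure_ext_of_integral_character fun k => ?_
  obtain ⟨r, hr⟩ : ∃ r : ℝ, r ∈ Set.Ioo (0 : ℝ) 1 := ⟨1 / 2, by norm_num⟩
  have hmem : ∀ η : Fin d → Circle, (fun j => (r : ℂ) * η j) ∈ polydisk d := by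
    intro η j
    rw [norm_mul, Circle.norm_coe, mul_one, Complex.norm_real, Real.norm_of_nonneg hr.1.le]
    exact hr.2
  have key : ∀ σ : Measure (Fin d → Circle), IsFiniteMeasure σ →
      ∫ η, character k η * ((∫ ζ, polyPoisson (fun j => (r : ℂ) * η j) ζ ∂σ : ℝ) : ℂ)
        ∂torusMeasure d = (∏ j, (r : ℂ) ^ (k j).natAbs) * ∫ ζ, character k ζ ∂σ := by
    intro σ _
    have hz : Continuous fun x : (Fin d → Circle) × (Fin d → Circle) =>
        fun j => (r : ℂ) * x.1 j := by
      refine continuous_pi fun j => continuous_const.mul (continuous_subtype_val.comp ?_)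
      fun_prop
    have hcP : Continuous fun x : (Fin d → Circle) × (Fin d → Circle) =>
        polyPoisson (fun j => (r : ℂ) * x.1 j) x.2 :=
      continuous_polyPoisson_comp hz continuous_snd fun x => hmem x.1
    have hc : Continuous fun x : (Fin d → Circle) × (Fin d → Circle) =>
        character k x.1 * (polyPoisson (fun j => (r : ℂ) * x.1 j) x.2 : ℂ) :=
      ((character k).continuous.comp continuous_fst).mul (Complex.continuous_ofReal.comp hcP)
    have h1 : ∀ η, character k η * ((∫ ζ, polyPoisson (fun j => (r : ℂ) * η j) ζ ∂σ : ℝ) : ℂ) =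
        ∫ ζ, character k η * (polyPoisson (fun j => (r : ℂ) * η j) ζ : ℂ) ∂σ := by
      intro η
      rw [integral_const_mul, integral_complex_ofReal]
    simp_rw [h1]
    rw [integral_integral_swap (integrable_of_continuous hc), ← integral_const_mul]
    refine integral_congr_ae (Eventually.of_forall fun ζ => ?_)
    have h2 : ∀ η : Fin d → Circle,
        character k η * (polyPoisson (fun j => (r : ℂ) * η j) ζ : ℂ) =
        ∏ j, ((diskPoisson (r * ζ j) (η j) : ℂ) * (η j : ℂ) ^ k j) := by
      intro η
      rw [character_apply, polyPoisson_eq_prod, Finset.prod_mul_distrib, mul_comm]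
      push_cast
      simp_rw [diskPoisson_symm]
    simp only [h2]
    rw [torusMeasure, integral_fintype_prod_eq_prod (fun j η =>
      (diskPoisson (r * ζ j) η : ℂ) * (η : ℂ) ^ k j)]
    simp_rw [integral_diskPoisson_mul_zpow hr, Finset.prod_mul_distrib]
    rw [character_apply]
  have h1 := key μ inferInstance
  have h2 := key ν inferInstance
  have h3 : ∀ η : Fin d → Circle, ∫ ζ, polyPoisson (fun j => (r : ℂ) * η j) ζ ∂μ =
      ∫ ζ, polyPoisson (fun j => (r : ℂ) * η j) ζ ∂ν := fun η => h _ (hmem η)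
  simp only [h3] at h1
  rw [h1] at h2
  refine mul_left_cancel₀ (Finset.prod_ne_zero_iff.2 fun j _ => pow_ne_zero _ ?_) h2
  exact_mod_cast hr.1.ne'

/-! ### The maximum principle and the Poisson integral of the Clark function -/

/-- The maximum principle with respect to the distinguished boundary of the polydisk. -/
theorem norm_le_of_forall_torus {d : ℕ} {F : (Fin d → ℂ) → ℂ}
    (hF : ContinuousOn F (closedPolydisk d))
    (hF' : ∀ z ∈ closedPolydisk d, ∀ j,
      DifferentiableOn ℂ (fun w => F (Function.update z j w)) (Metric.ball 0 1))
    {C : ℝ} (hC : ∀ ζ, ‖F (toComplex ζ)‖ ≤ C) {z : Fin d → ℂ} (hz : z ∈ closedPolydisk d) :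
    ‖F z‖ ≤ C := by
  have hopen : ∀ z ∈ polydisk d, ‖F z‖ ≤ C := by
    intro z hz
    have hone : ∫ ζ, polyPoisson z ζ ∂torusMeasure d = 1 := by
      have := integral_polyPoisson_mul (F := fun _ => (1 : ℂ)) continuousOn_const
        (fun _ _ _ => differentiableOn_const _) hz
      simp only [mul_one] at this
      rw [integral_complex_ofReal] at this
      exact_mod_cast this
    rw [← integral_polyPoisson_mul hF hF' hz]
    calc _ ≤ ∫ ζ, polyPoisson z ζ * C ∂torusMeasure d := by
          refine norm_integral_le_of_norm_le (integrable_of_continuous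
            ((continuous_polyPoisson hz).mul continuous_const))
            (Eventually.of_forall fun ζ => ?_)
          rw [norm_mul, Complex.norm_real, Real.norm_of_nonneg (polyPoisson_nonneg hz ζ)]
          exact mul_le_mul_of_nonneg_left (hC ζ) (polyPoisson_nonneg hz ζ)
      _ = C := by rw [integral_mul_const, hone, one_mul]
  -- a point of the closed polydisk is the limit of `r z` as `r → 1`
  have hr : ∀ r : ℝ, r ∈ Set.Ioo (0 : ℝ) 1 → (fun j => (r : ℂ) * z j) ∈ polydisk d := by
    intro r hr j
    rw [norm_mul, Complex.norm_real, Real.norm_of_nonneg hr.1.le]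
    calc r * ‖z j‖ ≤ r * 1 := by gcongr; exacts [hr.1.le, hz j]
      _ < 1 := by linarith [hr.2]
  have hev : ∀ᶠ r : ℝ in 𝓝[<] 1, r ∈ Set.Ioo (0 : ℝ) 1 := Ioo_mem_nhdsLT one_pos
  have ht : Tendsto (fun r : ℝ => fun j => (r : ℂ) * z j) (𝓝[<] 1) (𝓝[closedPolydisk d] z) := by
    refine tendsto_nhdsWithin_iff.2 ⟨?_, ?_⟩
    · have h1 : Continuous fun r : ℝ => fun j => (r : ℂ) * z j := by fun_prop
      have h2 := h1.tendsto 1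
      simp only [Complex.ofReal_one, one_mul] at h2
      exact h2.mono_left nhdsWithin_le_nhds
    · filter_upwards [hev] with r h using polydisk_subset_closedPolydisk (hr r h)
  refine le_of_tendsto ((hF z hz).tendsto.comp ht).norm ?_
  filter_upwards [hev] with r h using hopen _ (hr r h)

section clark

variable {d : ℕ} {p : MvPolynomial (Fin (d + 1)) ℂ}

theorem analyticAt_quotientFun_joinLastC (hp : ∀ z ∈ closedPolydisk (d + 1), eval z p ≠ 0)
    {z : Fin d → ℂ} (hz : z ∈ closedPolydisk d) {w : ℂ} (hw : ‖w‖ ≤ 1) :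
    AnalyticAt ℂ (fun x => quotientFun p (joinLastC x w)) z := by
  refine AnalyticAt.fun_comp (analyticAt_quotientFun
    (hp _ (joinLastC_mem_closedPolydisk hz hw))) ?_
  have h1 : ContDiff ℂ ⊤ fun x : Fin d → ℂ => joinLastC x w :=
    contDiff_joinLastC.comp (contDiff_id.prodMk contDiff_const)
  exact h1.contDiffAt.analyticAt

/-- Compactness of the torus gives a bound less than `1` on `𝕋ᵈ × {w}`, which the maximum principle
extends to the closed polydisk. -/
theorem norm_quotientFun_lt_one (hp : ∀ z ∈ closedPolydisk (d + 1), eval z p ≠ 0)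
    (hpos : 0 < p.degreeOf (Fin.last d)) {z : Fin d → ℂ} (hz : z ∈ closedPolydisk d) {w : ℂ}
    (hw : ‖w‖ < 1) : ‖quotientFun p (joinLastC z w)‖ < 1 := by
  have ha : ∀ x ∈ closedPolydisk d, AnalyticAt ℂ (fun x => quotientFun p (joinLastC x w)) x :=
    fun x hx => analyticAt_quotientFun_joinLastC hp hx hw.le
  have hc : ContinuousOn (fun x => quotientFun p (joinLastC x w)) (closedPolydisk d) :=
    fun x hx => (ha x hx).continuousAt.continuousWithinAt
  have hc' : Continuous fun ζ : Fin d → Circle => ‖quotientFun p (joinLastC (toComplex ζ) w)‖ :=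
    (hc.comp_continuous continuous_toComplex toComplex_mem_closedPolydisk).norm
  obtain ⟨ζ₀, -, hζ₀⟩ := isCompact_univ.exists_isMaxOn Set.univ_nonempty hc'.continuousOn
  refine lt_of_le_of_lt (norm_le_of_forall_torus hc (fun x hx j v hv => ?_)
    (fun ζ => hζ₀ (Set.mem_univ ζ)) hz) ?_
  · have hm := update_mem_closedPolydisk hx j (mem_ball_zero_iff.1 hv).le
    exact ((ha _ hm).differentiableAt.comp (f := Function.update x j) v
      (hasDerivAt_update x j v).differentiableAt).differentiableWithinAt
  · have := (isBlaschkePair_slice hp hpos ζ₀).norm_div_lt_one hw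
    rwa [eval_slice_div] at this

/-- For fixed `w` in the disk, `(1 - |φ|²) / |α - φ|² = Re ((α + φ) / (α - φ))` is the Poisson
integral of its values on `𝕋ᵈ × {w}`. -/
theorem integral_polyPoisson_mul_clark (hp : ∀ z ∈ closedPolydisk (d + 1), eval z p ≠ 0)
    (hpos : 0 < p.degreeOf (Fin.last d)) (α : Circle) {z : Fin d → ℂ} (hz : z ∈ polydisk d) {w : ℂ}
    (hw : ‖w‖ < 1) :
    ∫ ζ, polyPoisson z ζ * ((1 - ‖quotientFun p (joinLastC (toComplex ζ) w)‖ ^ 2) /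
        ‖(α : ℂ) - quotientFun p (joinLastC (toComplex ζ) w)‖ ^ 2) ∂torusMeasure d =
      (1 - ‖quotientFun p (joinLastC z w)‖ ^ 2) /
        ‖(α : ℂ) - quotientFun p (joinLastC z w)‖ ^ 2 := by
  set φ : (Fin d → ℂ) → ℂ := fun x => quotientFun p (joinLastC x w) with hφ
  set F : (Fin d → ℂ) → ℂ := fun x => (α + φ x) / (α - φ x) with hF
  have hne : ∀ x ∈ closedPolydisk d, (α : ℂ) - φ x ≠ 0 := by
    intro x hx
    exact circle_sub_ne_zero α (norm_quotientFun_lt_one hp hpos hx hw)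
  have ha : ∀ x ∈ closedPolydisk d, AnalyticAt ℂ F x := by
    intro x hx
    have h1 : AnalyticAt ℂ φ x := analyticAt_quotientFun_joinLastC hp hx hw.le
    exact (analyticAt_const.add h1).div (analyticAt_const.sub h1) (hne x hx)
  have hFc : ContinuousOn F (closedPolydisk d) :=
    fun x hx => (ha x hx).continuousAt.continuousWithinAt
  have hP := integral_polyPoisson_mul hFc (fun x hx j v hv => by
    have hm := update_mem_closedPolydisk hx j (mem_ball_zero_iff.1 hv).le
    exact ((ha _ hm).differentiableAt.comp (f := Function.update x j) v
      (hasDerivAt_update x j v).differentiableAt).differentiableWithinAt) hz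
  have hre : ∀ x, (F x).re = (1 - ‖φ x‖ ^ 2) / ‖(α : ℂ) - φ x‖ ^ 2 := by
    intro x
    simp only [hF]
    rw [re_add_div_sub, Circle.norm_coe, one_pow]
  have hint : Integrable (fun ζ => (polyPoisson z ζ : ℂ) * F (toComplex ζ)) (torusMeasure d) :=
    integrable_of_continuous ((Complex.continuous_ofReal.comp (continuous_polyPoisson hz)).mul
      (hFc.comp_continuous continuous_toComplex toComplex_mem_closedPolydisk))
  have h2 := congrArg Complex.re hP
  rw [← Complex.reCLM_apply, ← ContinuousLinearMap.integral_comp_comm _ hint] at h2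
  simp only [Complex.reCLM_apply, Complex.re_ofReal_mul, hre] at h2
  exact h2

/-! ### The Clark measure carried by the branches -/

instance : NullSingletonClass arcLength where
  measure_singleton x := by
    have h2 : (Circle.exp ⁻¹' {x} ∩ Set.Ioc 0 (2 * Real.pi)).Subsingleton := by
      intro a ha b hb
      exact Circle.exp_injOn_Ioc (by simp) ha.2 hb.2
        ((Set.mem_singleton_iff.1 ha.1).trans (Set.mem_singleton_iff.1 hb.1).symm)
    have hm : MeasurableSet ({x} : Set Circle) := measurableSet_singleton x
    rw [arcLength, Measure.smul_apply,
      Measure.map_apply Circle.exp.continuous.measurable hm,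
      Measure.restrict_apply (Circle.exp.continuous.measurable hm), h2.measure_zero, smul_zero]

theorem AnalyticAtTorus.continuousAt {g : (Fin d → Circle) → Circle} {ζ : Fin d → Circle}
    (h : AnalyticAtTorus g ζ) : ContinuousAt g ζ := by
  obtain ⟨G, hG, hGg⟩ := h
  have h1 : ContinuousAt (fun η => G (toComplex η)) ζ :=
    hG.continuousAt.comp continuous_toComplex.continuousAt
  exact (Topology.IsInducing.subtypeVal.continuousAt_iff (f := g)).2
    (h1.congr (hGg.mono fun _ h => h.symm))

theorem aemeasurable_of_analyticAtTorus {τ : Fin d → Circle} {g : (Fin d → Circle) → Circle}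
    (hg : ∀ ζ, (∀ i, ζ i ≠ τ i) → AnalyticAtTorus g ζ) : AEMeasurable g (torusMeasure d) := by
  set s : Set (Fin d → Circle) := {ζ | ∀ i, ζ i ≠ τ i} with hs
  have hso : IsOpen s := by
    have : s = ⋂ i, {ζ | ζ i ≠ τ i} := by
      ext
      simp [hs]
    rw [this]
    exact isOpen_iInter_of_finite fun i => isOpen_ne_fun (continuous_apply i) continuous_const
  have hae : ∀ᵐ ζ ∂torusMeasure d, ζ ∈ s := by
    simp only [hs, Set.mem_ofPred_eq]
    exact ae_all_iff.2 fun i => Measure.ae_eval_ne (fun _ => arcLength) i (τ i)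
  have hc : ContinuousOn g s := fun ζ hζ => (hg ζ hζ).continuousAt.continuousWithinAt
  have := hc.aemeasurable (μ := torusMeasure d) hso.measurableSet
  rwa [Measure.restrict_eq_self_of_ae_mem hae] at this

/-- The measure `∑ⱼ |∂φ/∂w|⁻¹ dm` on the union of the graphs of the functions `gⱼ`, as a sum of
push-forwards of `m` with a density on the torus. The functions `gⱼ` need only be measurable almost
everywhere: their values on the cuts are arbitrary. -/
noncomputable def branchMeasure {N : ℕ} (φ : (Fin (d + 1) → ℂ) → ℂ)
    (g : Fin N → (Fin d → Circle) → Circle) : Measure (Fin (d + 1) → Circle) :=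
  (∑ j, (torusMeasure d).map fun ζ => joinLast ζ (g j ζ)).withDensity
    fun ζ => ((‖partialLast φ (toComplex ζ)‖₊⁻¹ : NNReal) : ENNReal)

section branchMeasure

variable {N : ℕ} {α : Circle} {τ : Fin d → Circle} {g : Fin N → (Fin d → Circle) → Circle}

theorem IsParametrization.aemeasurable_joinLast
    (hg : IsParametrization (quotientFun p) α τ g) (j : Fin N) :
    AEMeasurable (fun ζ => joinLast ζ (g j ζ)) (torusMeasure d) :=
  continuous_joinLast.measurable.comp_aemeasurable
    (aemeasurable_id.prodMk (aemeasurable_of_analyticAtTorus (hg.analytic j)))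

theorem continuous_inv_nnnorm_partialLast (hp : ∀ z ∈ closedPolydisk (d + 1), eval z p ≠ 0)
    (hpos : 0 < p.degreeOf (Fin.last d)) :
    Continuous fun ζ : Fin (d + 1) → Circle =>
      ‖partialLast (quotientFun p) (toComplex ζ)‖₊⁻¹ :=
  (continuous_partialLast hp).nnnorm.inv₀ fun ζ =>
    nnnorm_ne_zero_iff.2 (partialLast_ne_zero hp hpos ζ)

theorem isFiniteMeasure_branchMeasure (hp : ∀ z ∈ closedPolydisk (d + 1), eval z p ≠ 0)
    (hpos : 0 < p.degreeOf (Fin.last d)) (g : Fin N → (Fin d → Circle) → Circle) :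
    IsFiniteMeasure (branchMeasure (quotientFun p) g) := by
  refine isFiniteMeasure_withDensity (ne_of_lt ?_)
  refine IsFiniteMeasure.lintegral_lt_top_of_bounded_to_ennreal _ ?_
  obtain ⟨ζ₀, -, hζ₀⟩ := isCompact_univ.exists_isMaxOn Set.univ_nonempty
    (continuous_inv_nnnorm_partialLast hp hpos).continuousOn
  exact ⟨_, fun ζ => ENNReal.coe_le_coe.2 (hζ₀ (Set.mem_univ ζ))⟩

theorem IsParametrization.integrable (hp : ∀ z ∈ closedPolydisk (d + 1), eval z p ≠ 0)
    (hpos : 0 < p.degreeOf (Fin.last d)) (hg : IsParametrization (quotientFun p) α τ g)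
    {f : (Fin (d + 1) → Circle) → ℂ} (hf : Continuous f) (j : Fin N) :
    Integrable (fun ζ => f (joinLast ζ (g j ζ)) /
      (‖partialLast (quotientFun p) (toComplex (joinLast ζ (g j ζ)))‖ : ℂ)) (torusMeasure d) := by
  have hc : Continuous fun ζ : Fin (d + 1) → Circle =>
      f ζ / (‖partialLast (quotientFun p) (toComplex ζ)‖ : ℂ) := by
    refine hf.div (Complex.continuous_ofReal.comp (continuous_partialLast hp).norm) fun ζ => ?_
    exact_mod_cast norm_ne_zero_iff.2 (partialLast_ne_zero hp hpos ζ)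
  have := hg.aemeasurable_joinLast j
  exact (integrable_map_measure hc.aestronglyMeasurable this).1 (integrable_of_continuous hc)

theorem IsParametrization.integral_branchMeasure
    (hp : ∀ z ∈ closedPolydisk (d + 1), eval z p ≠ 0)
    (hpos : 0 < p.degreeOf (Fin.last d)) (hg : IsParametrization (quotientFun p) α τ g)
    {f : (Fin (d + 1) → Circle) → ℂ} (hf : Continuous f) :
    ∫ ζ, f ζ ∂branchMeasure (quotientFun p) g =
      ∑ j, ∫ ζ, f (joinLast ζ (g j ζ)) /
        (‖partialLast (quotientFun p) (toComplex (joinLast ζ (g j ζ)))‖ : ℂ) ∂torusMeasure d := by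
  have hW := continuous_inv_nnnorm_partialLast hp hpos
  have hc : Continuous fun ζ : Fin (d + 1) → Circle =>
      ‖partialLast (quotientFun p) (toComplex ζ)‖₊⁻¹ • f ζ := hW.smul hf
  rw [branchMeasure, integral_withDensity_eq_integral_smul hW.measurable,
    integral_finsetSum_measure fun j _ => integrable_of_continuous hc]
  refine Finset.sum_congr rfl fun j _ => ?_
  rw [integral_map (hg.aemeasurable_joinLast j) hc.aestronglyMeasurable]
  refine integral_congr_ae (Eventually.of_forall fun ζ => ?_)
  simp only [NNReal.smul_def, NNReal.coe_inv, coe_nnnorm, Complex.real_smul, Complex.ofReal_inv]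
  rw [div_eq_inv_mul]

end branchMeasure

/-- The measure carried by the branches is the Clark measure: integrate the one-variable formula
over `ζ' ∈ 𝕋ᵈ` against the Poisson kernel. -/
theorem IsParametrization.isClarkMeasure_branchMeasure
    (hp : ∀ z ∈ closedPolydisk (d + 1), eval z p ≠ 0)
    (hpos : 0 < p.degreeOf (Fin.last d)) {α : Circle} {τ : Fin d → Circle}
    {g : Fin (p.degreeOf (Fin.last d)) → (Fin d → Circle) → Circle}
    (hg : IsParametrization (quotientFun p) α τ g) :
    IsClarkMeasure (quotientFun p) α (branchMeasure (quotientFun p) g) where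
  finite := isFiniteMeasure_branchMeasure hp hpos g
  poisson_integral z hz := by
    obtain ⟨z', w, rfl⟩ := exists_eq_joinLastC z
    have hz' : z' ∈ polydisk d := fun i => by simpa using hz i.castSucc
    have hw : ‖w‖ < 1 := by simpa using hz (Fin.last d)
    have hc : Continuous fun ζ : Fin (d + 1) → Circle =>
        (polyPoisson (joinLastC z' w) ζ : ℂ) :=
      Complex.continuous_ofReal.comp (continuous_polyPoisson hz)
    have h1 := hg.integral_branchMeasure hp hpos hc
    rw [← integral_finsetSum _ fun j _ => hg.integrable hp hpos hc j,
      integral_complex_ofReal] at h1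
    rw [← integral_polyPoisson_mul_clark hp hpos α hz' hw]
    apply Complex.ofReal_injective
    rw [h1, ← integral_complex_ofReal]
    refine integral_congr_ae (Eventually.of_forall fun ζ => ?_)
    have hB := isBlaschkePair_slice hp hpos ζ
    have h2 := hB.clark_formula (Circle.norm_coe α) (fun j => (g j ζ : ℂ))
      (fun i j hij => hg.injective hp hpos ζ (Subtype.coe_injective hij))
      (fun j => Circle.norm_coe _)
      (fun j => by rw [eval_slice_div]; exact (hg.eq_iff hp ζ _).2 ⟨j, rfl⟩) hw
    rw [eval_slice_div] at h2
    simp only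
    rw [h2, Finset.mul_sum]
    push_cast
    refine Finset.sum_congr rfl fun j _ => ?_
    rw [polyPoisson_joinLast, toComplex_joinLast, partialLast_joinLastC]
    simp only [diskPoisson]
    push_cast
    ring

end clark

theorem IsClarkMeasure.unique {d : ℕ} {φ : (Fin d → ℂ) → ℂ} {α : Circle}
    {μ ν : Measure (Fin d → Circle)} (hμ : IsClarkMeasure φ α μ) (hν : IsClarkMeasure φ α ν) :
    μ = ν := by
  have := hμ.finite
  have := hν.finite
  exact measure_ext_of_integral_polyPoisson fun z hz => by
    rw [← hμ.poisson_integral z hz, ← hν.poisson_integral z hz]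

end PolydiskClark

open PolydiskClark in
theorem theorem3p4 (d : ℕ) (n : Fin (d + 1) → ℕ) (p : MvPolynomial (Fin (d + 1)) ℂ)
    (hdeg : HasPolydegree p n) (hpos : ∀ j, 0 < n j)
    (hstable : IsStable p)
    (hsing : ∀ z ∈ closedPolydisk (d + 1), ¬ IsSingularity p z)
    (α : Circle) :
    (∃! σ : Measure (Fin (d + 1) → Circle), IsClarkMeasure (quotientFun p) α σ) ∧
    (∀ τ : Fin d → Circle, ∃ g : Fin (n (Fin.last d)) → (Fin d → Circle) → Circle,
      IsParametrization (quotientFun p) α τ g) ∧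
    ∀ σ : Measure (Fin (d + 1) → Circle), IsClarkMeasure (quotientFun p) α σ →
    ∀ (τ : Fin d → Circle) (g : Fin (n (Fin.last d)) → (Fin d → Circle) → Circle),
      IsParametrization (quotientFun p) α τ g →
      (∀ j ζ', partialLast (quotientFun p) (toComplex (joinLast ζ' (g j ζ'))) ≠ 0) ∧
      ∀ f : C(Fin (d + 1) → Circle, ℂ),
        (∀ j, Integrable (fun ζ' : Fin d → Circle => f (joinLast ζ' (g j ζ')) /
          (‖partialLast (quotientFun p) (toComplex (joinLast ζ' (g j ζ')))‖ : ℂ))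
          (torusMeasure d)) ∧
        ∫ ζ, f ζ ∂σ =
          ∑ j, ∫ ζ', f (joinLast ζ' (g j ζ')) /
            (‖partialLast (quotientFun p) (toComplex (joinLast ζ' (g j ζ')))‖ : ℂ)
            ∂(torusMeasure d) := by
  obtain rfl : n = fun j => p.degreeOf j := funext fun j => (hdeg j).symm
  have hp := hstable.eval_ne_zero_of_not_isSingularity hsing
  have hlast := hpos (Fin.last d)
  refine ⟨?_, exists_isParametrization hp hlast α, fun σ hσ τ g hg => ⟨fun j ζ' =>
    partialLast_ne_zero hp hlast _, fun f => ⟨hg.integrable hp hlast f.continuous, ?_⟩⟩⟩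
  · obtain ⟨g, hg⟩ := exists_isParametrization hp hlast α fun _ => 1
    have hσ := hg.isClarkMeasure_branchMeasure hp hlast
    exact ⟨_, hσ, fun ν hν => hν.unique hσ⟩
  · rw [hσ.unique (hg.isClarkMeasure_branchMeasure hp hlast)]
    exact hg.integral_branchMeasure hp hlast f.continuous
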